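/- **Theorem.** Let $D=d/dz$. For $b>0$ let $\mathcal B_b$ be the space of entire functions $f:\mathbb C\to\mathbb C$ with $\|f\|_b=\sup_{k\ge 0} b^{-k}|f^{(k)}(0)|<\infty$. For $a\ge 0$ let $\mathcal A_a=\bigcap_{b>a}\mathcal B_b$, with the topology given by the norms $\|\cdot\|_b$, $b>a$. Let $\mathcal L^+$ be the set of Laguerre entire functions $$f(z)=Cz^m e^{\alpha z}\prod_{j=1}^\infty(1+\beta_j z),\qquad C\in\mathbb C,\ m\in\mathbb N_0,\ \alpha\ge 0,\ \beta_j\ge\beta_{j+1}\ge 0,\ \sum_j\beta_j<\infty,$$ and let $\mathcal L^+_a=\mathcal L^+\cap\mathcal A_a$ carry the topology induced from $\mathcal A_a$. For $\theta\ge 0$, $\omega\in\mathbb R$ put $$\Delta_{\theta,\omega}=(\theta+zD)D+\omega zD .$$ Let $\theta\ge 0$, $\omega\in\mathbb R$ (possibly negative), $a\ge 0$, $b\ge 0$ satisfy $b\,\omega^{-1}(e^{a\omega}-1)<1$, and let $$c=c(b)=b\,e^{a\omega}\bigl(1-b\,\omega^{-1}(e^{a\omega}-1)\bigr)^{-1},$$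 where $\omega^{-1}(e^{a\omega}-1)$ means $a$ if $\omega=0$. Then: 1. There is exactly one continuous linear operator $\exp(a\Delta_{\theta,\omega}):\mathcal A_b\to\mathcal A_c$ that is given on every polynomial $f$ by the series $$\bigl(\exp(a\Delta_{\theta,\omega})f\bigr)(z)=\sum_{k=0}^\infty\frac{a^k}{k!}\bigl(\Delta_{\theta,\omega}^k f\bigr)(z),\qquad z\in\mathbb C .$$ If moreover $b\,|\omega|^{-1}(e^{a|\omega|}-1)<1$ (which is automatic for $\omega\ge 0$), then this series converges to $\exp(a\Delta_{\theta,\omega})f$ at every $z\in\mathbb C$ for every $f\in\mathcal A_b$. 2. $\exp(a\Delta_{\theta,\omega})$ maps $\mathcal L^+_b$ into $\mathcal L^+_c$, and is continuous as a map from $\mathcal L^+_b$ into $\mathcal L^+_c$. -/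

import Mathlib

noncomputable section

namespace LaguerreOp

/-- `‖f‖_b = sup_k b^{-k} |f^{(k)}(0)|`; meaningful for `f` in `MemB b`. -/
def bNorm (b : ℝ) (f : ℂ → ℂ) : ℝ :=
  ⨆ k : ℕ, (b ^ k)⁻¹ * ‖iteratedDeriv k f 0‖

/-- Membership in `𝓑_b`: entire functions with `‖f‖_b < ∞`. -/
def MemB (b : ℝ) (f : ℂ → ℂ) : Prop :=
  Differentiable ℂ f ∧
    BddAbove (Set.range fun k : ℕ => (b ^ k)⁻¹ * ‖iteratedDeriv k f 0‖)

theorem iteratedDeriv_add_zero {f g : ℂ → ℂ} (hf : Differentiable ℂ f)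
    (hg : Differentiable ℂ g) (k : ℕ) :
    iteratedDeriv k (f + g) 0 = iteratedDeriv k f 0 + iteratedDeriv k g 0 :=
  iteratedDeriv_add hf.contDiff.contDiffAt hg.contDiff.contDiffAt

theorem iteratedDeriv_smul_zero {f : ℂ → ℂ} (r : ℂ) (hf : Differentiable ℂ f) (k : ℕ) :
    iteratedDeriv k (r • f) 0 = r * iteratedDeriv k f 0 := by
  rw [iteratedDeriv_const_smul hf.contDiff.contDiffAt r, smul_eq_mul]

theorem term_add_le {b : ℝ} (hb : 0 < b) {f g : ℂ → ℂ} (hf : MemB b f) (hg : MemB b g)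
    (k : ℕ) : (b ^ k)⁻¹ * ‖iteratedDeriv k (f + g) 0‖ ≤ bNorm b f + bNorm b g := by
  rw [iteratedDeriv_add_zero hf.1 hg.1]
  calc (b ^ k)⁻¹ * ‖iteratedDeriv k f 0 + iteratedDeriv k g 0‖
      ≤ (b ^ k)⁻¹ * (‖iteratedDeriv k f 0‖ + ‖iteratedDeriv k g 0‖) := by
        gcongr; exact norm_add_le _ _
    _ = (b ^ k)⁻¹ * ‖iteratedDeriv k f 0‖ + (b ^ k)⁻¹ * ‖iteratedDeriv k g 0‖ := by ring
    _ ≤ bNorm b f + bNorm b g := add_le_add (le_ciSup hf.2 k) (le_ciSup hg.2 k)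

theorem term_smul {b : ℝ} (r : ℂ) {f : ℂ → ℂ} (hf : MemB b f) (k : ℕ) :
    (b ^ k)⁻¹ * ‖iteratedDeriv k (r • f) 0‖ = ‖r‖ * ((b ^ k)⁻¹ * ‖iteratedDeriv k f 0‖) := by
  rw [iteratedDeriv_smul_zero r hf.1, norm_mul]; ring

theorem MemB.add {b : ℝ} (hb : 0 < b) {f g : ℂ → ℂ} (hf : MemB b f) (hg : MemB b g) :
    MemB b (f + g) :=
  ⟨hf.1.add hg.1, ⟨bNorm b f + bNorm b g, by
    rintro _ ⟨k, rfl⟩; exact term_add_le hb hf hg k⟩⟩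

theorem MemB.smul {b : ℝ} (r : ℂ) {f : ℂ → ℂ} (hf : MemB b f) : MemB b (r • f) :=
  ⟨hf.1.const_smul r, ⟨‖r‖ * bNorm b f, by
    rintro _ ⟨k, rfl⟩
    simp only [term_smul r hf k]
    exact mul_le_mul_of_nonneg_left (le_ciSup hf.2 k) (norm_nonneg r)⟩⟩

/-- The index set of the norms `‖·‖_b`, `b > a`, on `𝓐_a`; for `a ≥ 0`, the only case of
interest, the condition `0 < b` is automatic. -/
abbrev Idx (a : ℝ) : Type := {b : ℝ // 0 < b ∧ a < b}

/-- `𝓐_a = ⋂_{b > a} 𝓑_b` as a vector space of functions. -/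
def ASub (a : ℝ) : Submodule ℂ (ℂ → ℂ) where
  carrier := {f | ∀ b : Idx a, MemB (b : ℝ) f}
  add_mem' hf hg b := (hf b).add b.2.1 (hg b)
  zero_mem' b := ⟨differentiable_const 0, ⟨0, by
    rintro _ ⟨k, rfl⟩
    have h : iteratedDeriv k (0 : ℂ → ℂ) 0 = 0 := by
      have := iteratedDeriv_smul_zero (f := (0 : ℂ → ℂ)) 0 (differentiable_const 0) k
      simpa only [zero_smul, zero_mul] using this
    simp [h]⟩⟩
  smul_mem' r _ hf b := (hf b).smul r

/-- The space `𝓐_a`. It is a separate type so that it does not carry the topology of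
pointwise convergence of `ℂ → ℂ`. -/
def A (a : ℝ) : Type := ↥(ASub a)

instance (a : ℝ) : AddCommGroup (A a) := inferInstanceAs (AddCommGroup ↥(ASub a))

instance (a : ℝ) : Module ℂ (A a) := inferInstanceAs (Module ℂ ↥(ASub a))

instance (a : ℝ) : CoeFun (A a) (fun _ => ℂ → ℂ) := ⟨fun f => f.1⟩

/-- The norms `‖·‖_b`, `b > a`, on `𝓐_a`. -/
def normFamily (a : ℝ) : SeminormFamily ℂ (A a) (Idx a) := fun b =>
  Seminorm.of (fun f => bNorm (b : ℝ) f)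
    (fun f g => ciSup_le fun k => term_add_le b.2.1 (f.2 b) (g.2 b) k)
    (fun r f => by
      change (⨆ k : ℕ, ((b : ℝ) ^ k)⁻¹ * ‖iteratedDeriv k (r • f.1) 0‖) = _
      simp only [term_smul r (f.2 b)]
      exact (Real.mul_iSup_of_nonneg (norm_nonneg r) _).symm)

instance (a : ℝ) : Nonempty (Idx a) :=
  ⟨⟨max a 0 + 1, by positivity, by linarith [le_max_left a 0]⟩⟩

/-- The topology `𝓣_a` defined by the norms `‖·‖_b`, `b > a`. -/
instance (a : ℝ) : TopologicalSpace (A a) := (normFamily a).moduleFilterBasis.topology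

/-- The Laguerre entire functions `𝓛⁺`. -/
def IsLaguerre (f : ℂ → ℂ) : Prop :=
  ∃ (C : ℂ) (m : ℕ) (α : ℝ) (β : ℕ → ℝ), 0 ≤ α ∧ (∀ j, 0 ≤ β j) ∧ Antitone β ∧
    Summable β ∧
    ∀ z, f z = C * z ^ m * Complex.exp (α * z) * ∏' j, (1 + (β j : ℂ) * z)

/-- `𝓛⁺_a = 𝓛⁺ ∩ 𝓐_a`; as a subtype of `𝓐_a` it carries the topology induced by `𝓣_a`. -/
def Lplus (a : ℝ) : Set (A a) := {f | IsLaguerre f}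

/-- `Δ_{θ,ω} = (θ + zD)D + ωzD`. -/
def Delta (θ ω : ℝ) (f : ℂ → ℂ) : ℂ → ℂ := fun z =>
  (θ : ℂ) * deriv f z + z * deriv (deriv f) z + (ω : ℂ) * z * deriv f z

/-- The series `∑_{k ≥ 0} φ^{(k)}(0) / k! · (Δ_{θ,ω}^k f)(z)` converges to `g z` for every `z`. -/
def HasSeries (φ : ℂ → ℂ) (θ ω : ℝ) (f g : ℂ → ℂ) : Prop :=
  ∀ z, HasSum (fun k : ℕ => iteratedDeriv k φ 0 / (k.factorial : ℂ) * ((Delta θ ω)^[k] f) z) (g z)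

/-- `ω⁻¹(e^{aω} - 1)`, read as its limit `a` when `ω = 0`. -/
def gam (a ω : ℝ) : ℝ := if ω = 0 then a else ω⁻¹ * (Real.exp (a * ω) - 1)

/-- `c(b) = b e^{aω} (1 - b ω⁻¹[e^{aω} - 1])⁻¹`. -/
def cOf (a ω b : ℝ) : ℝ := b * Real.exp (a * ω) * (1 - b * gam a ω)⁻¹

/-- `E` is the operator `exp(aΔ_{θ,ω})` on `𝓐_b`: the continuous linear operator that is
given on polynomials by the power series of `exp(a ·)` in `Δ_{θ,ω}`. -/
def IsExpDelta (a θ ω : ℝ) {b c : ℝ} (E : A b →L[ℂ] A c) : Prop :=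
  ∀ (f : A b) (p : Polynomial ℂ), (∀ z, f z = p.eval z) →
    HasSeries (fun z => Complex.exp (a * z)) θ ω f (E f)

end LaguerreOp

end

/-!
On the sequence `u k = f^(k)(0)` the operator `Δ = (θ + zD) D + ω z D` acts as a bidiagonal matrix,
and `exp (a Δ)` factors as `exp (γ (θ + zD) D)`, `γ = ω⁻¹ (e^{aω} - 1)`, followed by the dilation
`z ↦ e^{aω} z`. The first factor has the explicit matrix `u k ↦ ∑ j, (θ + k)_j / j! γ^j u (k + j)`
with nonnegative entries, so the binomial series turns `‖u k‖ ≤ B r^k` into the bound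
`B (1 - rγ)^{-θ} (r / (1 - rγ))^k`. This gives existence, continuity and the constant `c(b)`. The
exponential series is dominated by its terms for `|ω|`, `|u|`, whose sum is finite if
`r |ω|⁻¹ (e^{a|ω|} - 1) < 1`. Uniqueness holds because polynomials are dense.

For a polynomial `p` all of whose roots are nonpositive, `exp (γ (θ + zD) D) p` is again of this
kind: by induction on the degree, with `p` replaced by `(X + x) p` the image `g` is replaced by an
explicit first and second order differential expression in `g`, and at a point `z = w²` with
`Re w > 0` the signs of the real parts of the logarithmic derivatives exclude a zero.

A Laguerre entire function is the limit of such polynomials whose coefficients increase, so all of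
them obey its bound `‖u k‖ ≤ B r^k` and the images converge too. Conversely a pointwise limit `F`,
`F(0) ≠ 0`, of such polynomials with converging derivatives at `0` is a Laguerre entire function:
the sums of the parameters `β_j` stay bounded, a diagonal subsequence converges, and the mass lost
from `∑ β_j` becomes the factor `e^{αz}`.
-/

noncomputable section

namespace LaguerreOp

open Filter Topology Finset Polynomial
open scoped Nat

theorem multichoose_eq_prod_div (s : ℝ) (j : ℕ) :
    Ring.multichoose s j = (∏ i ∈ range j, (s + i)) / (j ! : ℝ) := by
  rw [eq_div_iff (by positivity), mul_comm, ← nsmul_eq_mul,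
    Ring.factorial_nsmul_multichoose_eq_ascPochhammer, ascPochhammer_smeval_eq_eval]
  induction j with
  | zero => simp
  | succ j ih => rw [ascPochhammer_succ_eval, ih, prod_range_succ]

theorem multichoose_succ_mul (s : ℝ) (j : ℕ) :
    Ring.multichoose s (j + 1) * (j + 1) = s * Ring.multichoose (s + 1) j := by
  have shift : ∏ i ∈ range j, (s + ((i + 1 : ℕ) : ℝ)) = ∏ i ∈ range j, (s + 1 + i) :=
    prod_congr rfl fun i _ => by push_cast; ring
  rw [multichoose_eq_prod_div, multichoose_eq_prod_div, prod_range_succ', shift,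
    Nat.factorial_succ]
  push_cast
  field_simp
  ring

theorem multichoose_nonneg {s : ℝ} (hs : 0 ≤ s) (j : ℕ) : 0 ≤ Ring.multichoose s j := by
  rw [multichoose_eq_prod_div]
  positivity

theorem multichoose_pos {s : ℝ} (hs : 0 < s) (j : ℕ) : 0 < Ring.multichoose s j := by
  rw [multichoose_eq_prod_div]
  positivity

theorem hasSum_multichoose_mul_pow (s : ℝ) {x : ℝ} (hx : |x| < 1) :
    HasSum (fun j => Ring.multichoose s j * x ^ j) ((1 - x) ^ (-s)) := by
  have h := (Real.one_div_one_sub_rpow_hasFPowerSeriesOnBall_zero s).hasSum (y := x) (by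
    simpa [enorm_eq_nnnorm, ← NNReal.coe_lt_coe] using hx)
  simp only [zero_add, one_div, ← Real.rpow_neg (by linarith [le_abs_self x] : 0 ≤ 1 - x)] at h
  refine h.congr_fun fun j => ?_
  simp [Ring.multichoose_eq, mul_comm]

/-- The derivatives of `f` at `0`; an entire function is determined by this sequence, and all
operators below are studied through their action on it. -/
def derivs (f : ℂ → ℂ) (k : ℕ) : ℂ := iteratedDeriv k f 0

/-- Geometric growth of a sequence. For `u = derivs f` it says that `‖f‖_r ≤ B`. -/
def GeomBound (B r : ℝ) (u : ℕ → ℂ) : Prop := ∀ k, ‖u k‖ ≤ B * r ^ k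

theorem GeomBound.nonneg {B r : ℝ} {u : ℕ → ℂ} (hu : GeomBound B r u) : 0 ≤ B := by
  simpa using (norm_nonneg _).trans (hu 0)

theorem GeomBound.shift {B r : ℝ} {u : ℕ → ℂ} (hu : GeomBound B r u) :
    GeomBound (B * r) r fun k => u (k + 1) :=
  fun k => (hu (k + 1)).trans_eq (by ring)

/-- The exponential generating function of `u`. It is the entire function with `derivs u` when
`u` grows at most geometrically. -/
def egf (u : ℕ → ℂ) (z : ℂ) : ℂ := ∑' k, u k / (k ! : ℂ) * z ^ k

theorem norm_egf_term_le {u : ℕ → ℂ} {B r : ℝ} (hu : GeomBound B r u) {z : ℂ} {R : ℝ}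
    (hz : ‖z‖ ≤ R) (k : ℕ) : ‖u k / (k ! : ℂ) * z ^ k‖ ≤ B * ((r * R) ^ k / (k ! : ℝ)) := by
  have bound_nonneg : 0 ≤ B * r ^ k := (norm_nonneg _).trans (hu k)
  calc ‖u k / (k ! : ℂ) * z ^ k‖ = ‖u k‖ / (k ! : ℝ) * ‖z‖ ^ k := by
        rw [norm_mul, norm_div, norm_pow, Complex.norm_natCast]
    _ ≤ B * r ^ k / (k ! : ℝ) * R ^ k := by
        gcongr
        exact hu k
    _ = B * ((r * R) ^ k / (k ! : ℝ)) := by rw [mul_pow]; ring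

theorem summable_egf_bound (B r R : ℝ) : Summable fun k : ℕ => B * ((r * R) ^ k / (k ! : ℝ)) :=
  (Real.summable_pow_div_factorial _).mul_left _

theorem summable_egf {u : ℕ → ℂ} {B r : ℝ} (hu : GeomBound B r u) (z : ℂ) :
    Summable fun k => u k / (k ! : ℂ) * z ^ k :=
  .of_norm_bounded (summable_egf_bound B r ‖z‖) (norm_egf_term_le hu le_rfl)

@[simp] theorem egf_zero (u : ℕ → ℂ) : egf u 0 = u 0 := by
  rw [egf, tsum_eq_single 0 fun k hk => by simp [hk]]
  simp

theorem hasDerivAt_egf {u : ℕ → ℂ} {B r : ℝ} (hu : GeomBound B r u) (z : ℂ) :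
    HasDerivAt (egf u) (egf (fun k => u (k + 1)) z) z := by
  have hz : z ∈ Metric.ball (0 : ℂ) (‖z‖ + 1) := by simp
  have term_diff : ∀ k : ℕ, DifferentiableOn ℂ (fun w : ℂ => u k / (k ! : ℂ) * w ^ k)
      (Metric.ball 0 (‖z‖ + 1)) := fun k => by fun_prop
  have term_le : ∀ (k : ℕ) (w : ℂ), w ∈ Metric.ball (0 : ℂ) (‖z‖ + 1) →
      ‖u k / (k ! : ℂ) * w ^ k‖ ≤ B * ((r * (‖z‖ + 1)) ^ k / (k ! : ℝ)) := fun k w hw =>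
    norm_egf_term_le hu (mem_ball_zero_iff.1 hw).le k
  have diffAt : DifferentiableAt ℂ (egf u) z :=
    (Complex.differentiableOn_tsum_of_summable_norm (summable_egf_bound B r (‖z‖ + 1))
      term_diff Metric.isOpen_ball term_le).differentiableAt (Metric.isOpen_ball.mem_nhds hz)
  have sum_deriv : HasSum (fun k => deriv (fun w : ℂ => u k / (k ! : ℂ) * w ^ k) z)
      (deriv (egf u) z) :=
    Complex.hasSum_deriv_of_summable_norm (summable_egf_bound B r (‖z‖ + 1))
      term_diff Metric.isOpen_ball term_le hz
  have deriv_eq : deriv (egf u) z = egf (fun k => u (k + 1)) z := by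
    refine sum_deriv.unique ((hasSum_nat_add_iff' 1).1 ?_)
    simp only [range_one, sum_singleton, pow_zero, mul_one, deriv_const, sub_zero]
    refine (summable_egf hu.shift z).hasSum.congr_fun fun k => ?_
    have factorial_ne : (k ! : ℂ) ≠ 0 := by exact_mod_cast k.factorial_ne_zero
    have succ_ne : (k : ℂ) + 1 ≠ 0 := by exact_mod_cast k.succ_ne_zero
    rw [deriv_const_mul_field, deriv_pow_field, Nat.factorial_succ]
    push_cast
    field_simp
  exact deriv_eq ▸ diffAt.hasDerivAt

theorem differentiable_egf {u : ℕ → ℂ} {B r : ℝ} (hu : GeomBound B r u) :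
    Differentiable ℂ (egf u) := fun z => (hasDerivAt_egf hu z).differentiableAt

theorem derivs_egf {u : ℕ → ℂ} {B r : ℝ} (hu : GeomBound B r u) : derivs (egf u) = u := by
  ext n
  induction n generalizing u B with
  | zero => simp [derivs]
  | succ n ih =>
    rw [derivs, iteratedDeriv_succ', funext fun z => (hasDerivAt_egf hu z).deriv]
    exact ih hu.shift

theorem hasSum_derivs {f : ℂ → ℂ} (hf : Differentiable ℂ f) (z : ℂ) :
    HasSum (fun k : ℕ => derivs f k / (k ! : ℂ) * z ^ k) (f z) := by
  refine (Complex.hasSum_taylorSeries_of_entire hf 0 z).congr_fun fun k => ?_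
  simp only [derivs, sub_zero, smul_eq_mul]
  ring

theorem egf_derivs {f : ℂ → ℂ} (hf : Differentiable ℂ f) : egf (derivs f) = f :=
  funext fun z => (hasSum_derivs hf z).tsum_eq

theorem derivs_injOn : Set.InjOn derivs {f | Differentiable ℂ f} := fun f hf g hg h => by
  rw [← egf_derivs hf, h, egf_derivs hg]

theorem derivs_add {f g : ℂ → ℂ} (hf : Differentiable ℂ f) (hg : Differentiable ℂ g) :
    derivs (f + g) = derivs f + derivs g :=
  funext fun k => iteratedDeriv_add_zero hf hg k

theorem derivs_smul (s : ℂ) {f : ℂ → ℂ} (hf : Differentiable ℂ f) :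
    derivs (s • f) = s • derivs f :=
  funext fun k => iteratedDeriv_smul_zero s hf k

theorem derivs_deriv (f : ℂ → ℂ) : derivs (deriv f) = fun k => derivs f (k + 1) :=
  funext fun k => by rw [derivs, derivs, iteratedDeriv_succ']

/-- The action of multiplication by `z` on the sequence of derivatives at `0`. -/
def mulSeq (u : ℕ → ℂ) : ℕ → ℂ
  | 0 => 0
  | k + 1 => (k + 1) * u k

theorem derivs_id_mul {g : ℂ → ℂ} (hg : Differentiable ℂ g) :
    derivs (fun z => z * g z) = mulSeq (derivs g) := by
  ext k
  rw [derivs, iteratedDeriv_fun_mul contDiffAt_fun_id hg.contDiff.contDiffAt]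
  cases k with
  | zero => simp [mulSeq]
  | succ k => simp [iteratedDeriv_fun_id_zero, mulSeq, derivs]

theorem MemB.geomBound {r : ℝ} (hr : 0 < r) {f : ℂ → ℂ} (hf : MemB r f) :
    GeomBound (bNorm r f) r (derivs f) := fun k => by
  have h := le_ciSup hf.2 k
  rwa [inv_mul_le_iff₀ (by positivity), mul_comm] at h

theorem GeomBound.memB {r B : ℝ} (hr : 0 < r) {f : ℂ → ℂ} (hf : Differentiable ℂ f)
    (h : GeomBound B r (derivs f)) : MemB r f := by
  refine ⟨hf, B, ?_⟩
  rintro _ ⟨k, rfl⟩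
  exact (inv_mul_le_iff₀ (by positivity)).2 ((h k).trans_eq (mul_comm _ _))

theorem GeomBound.bNorm_le {r B : ℝ} (hr : 0 < r) {f : ℂ → ℂ} (h : GeomBound B r (derivs f)) :
    bNorm r f ≤ B :=
  ciSup_le fun k => (inv_mul_le_iff₀ (by positivity)).2 ((h k).trans_eq (mul_comm _ _))

/-! ### The operator on sequences of derivatives -/

/-- The action of `exp (γ (θ + zD) D)` on the sequence of derivatives at `0`. -/
def expSeq (θ γ : ℝ) (u : ℕ → ℂ) (k : ℕ) : ℂ :=
  ∑' j, ((Ring.multichoose (θ + k) j * γ ^ j : ℝ) : ℂ) * u (k + j)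

theorem norm_expSeq_term_le {θ γ : ℝ} (hθ : 0 ≤ θ) (hγ : 0 ≤ γ) {u : ℕ → ℂ} {B r : ℝ}
    (hu : GeomBound B r u) (k j : ℕ) :
    ‖((Ring.multichoose (θ + k) j * γ ^ j : ℝ) : ℂ) * u (k + j)‖ ≤
      B * r ^ k * (Ring.multichoose (θ + k) j * (r * γ) ^ j) := by
  have coeff_nonneg := multichoose_nonneg (by positivity : 0 ≤ θ + k) j
  rw [norm_mul, Complex.norm_real, Real.norm_of_nonneg (by positivity)]
  calc Ring.multichoose (θ + k) j * γ ^ j * ‖u (k + j)‖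
      ≤ Ring.multichoose (θ + k) j * γ ^ j * (B * r ^ (k + j)) := by gcongr; exact hu _
    _ = _ := by rw [mul_pow, pow_add]; ring

theorem hasSum_expSeq_bound {θ γ B r : ℝ} (hγ : 0 ≤ γ) (hr : 0 ≤ r) (hrγ : r * γ < 1) (k : ℕ) :
    HasSum (fun j => B * r ^ k * (Ring.multichoose (θ + k) j * (r * γ) ^ j))
      (B * (1 - r * γ) ^ (-θ) * (r * (1 - r * γ)⁻¹) ^ k) := by
  have hx : |r * γ| < 1 := by rwa [abs_of_nonneg (by positivity)]
  convert! (hasSum_multichoose_mul_pow (θ + k) hx).mul_left (B * r ^ k) using 1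
  rw [neg_add, Real.rpow_add (sub_pos.2 hrγ), Real.rpow_neg_natCast, zpow_neg, zpow_natCast,
    mul_pow, inv_pow]
  ring

theorem summable_expSeq {θ γ : ℝ} (hθ : 0 ≤ θ) (hγ : 0 ≤ γ) {u : ℕ → ℂ} {B r : ℝ}
    (hr : 0 ≤ r) (hrγ : r * γ < 1) (hu : GeomBound B r u) (k : ℕ) :
    Summable fun j => ((Ring.multichoose (θ + k) j * γ ^ j : ℝ) : ℂ) * u (k + j) :=
  .of_norm_bounded (hasSum_expSeq_bound hγ hr hrγ k).summable (norm_expSeq_term_le hθ hγ hu k)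

theorem GeomBound.expSeq {θ γ : ℝ} (hθ : 0 ≤ θ) (hγ : 0 ≤ γ) {u : ℕ → ℂ} {B r : ℝ}
    (hr : 0 ≤ r) (hrγ : r * γ < 1) (hu : GeomBound B r u) :
    GeomBound (B * (1 - r * γ) ^ (-θ)) (r * (1 - r * γ)⁻¹) (expSeq θ γ u) := fun k =>
  tsum_of_norm_bounded (hasSum_expSeq_bound hγ hr hrγ k) (norm_expSeq_term_le hθ hγ hu k)

theorem expSeq_add {θ γ : ℝ} (hθ : 0 ≤ θ) (hγ : 0 ≤ γ) {u v : ℕ → ℂ} {B B' r : ℝ} (hr : 0 ≤ r)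
    (hrγ : r * γ < 1) (hu : GeomBound B r u) (hv : GeomBound B' r v) :
    expSeq θ γ (u + v) = expSeq θ γ u + expSeq θ γ v := by
  ext k
  simp only [expSeq, Pi.add_apply, mul_add]
  exact (summable_expSeq hθ hγ hr hrγ hu k).tsum_add (summable_expSeq hθ hγ hr hrγ hv k)

theorem expSeq_smul (θ γ : ℝ) (s : ℂ) (u : ℕ → ℂ) : expSeq θ γ (s • u) = s • expSeq θ γ u := by
  ext k
  simp only [expSeq, Pi.smul_apply, smul_eq_mul, ← tsum_mul_left, mul_left_comm]

theorem gam_nonneg {a : ℝ} (ha : 0 ≤ a) (ω : ℝ) : 0 ≤ gam a ω := by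
  unfold gam
  split_ifs with h
  · exact ha
  · rcases lt_or_gt_of_ne h with h | h
    · have : Real.exp (a * ω) ≤ 1 :=
        Real.exp_le_one_iff.2 (mul_nonpos_of_nonneg_of_nonpos ha h.le)
      exact mul_nonneg_of_nonpos_of_nonpos (inv_nonpos.2 h.le) (by linarith)
    · have : 1 ≤ Real.exp (a * ω) := Real.one_le_exp (by positivity)
      exact mul_nonneg (inv_nonneg.2 h.le) (by linarith)

theorem cOf_nonneg {a ω b : ℝ} (hb : 0 ≤ b) (hab : b * gam a ω < 1) : 0 ≤ cOf a ω b :=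
  mul_nonneg (by positivity) (inv_nonneg.2 (by linarith))

theorem exists_cOf_lt {a ω b c : ℝ} (hab : b * gam a ω < 1) (hc : cOf a ω b < c) :
    ∃ r, b < r ∧ r * gam a ω < 1 ∧ cOf a ω r < c := by
  have cont_mul : ContinuousAt (fun r => r * gam a ω) b := by fun_prop
  have cont_cOf : ContinuousAt (cOf a ω) b := by
    unfold cOf
    exact ContinuousAt.mul (by fun_prop) (ContinuousAt.inv₀ (by fun_prop) (by linarith))
  have near := (cont_mul.eventually_lt_const hab).and (cont_cOf.eventually_lt_const hc)
  obtain ⟨r, ⟨hr, hrc⟩, hbr⟩ := ((near.filter_mono nhdsWithin_le_nhds).and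
    (self_mem_nhdsWithin (s := Set.Ioi b))).exists
  exact ⟨r, hbr, hr, hrc⟩

/-- The action of `exp (a Δ_{θ,ω})` on the sequence of derivatives at `0`; it reflects the
factorisation `exp (a Δ_{θ,ω}) = exp (aω zD) exp (γ (θ + zD) D)` with `γ = ω⁻¹ (e^{aω} - 1)`. -/
def expDeltaSeq (a θ ω : ℝ) (u : ℕ → ℂ) (k : ℕ) : ℂ :=
  (Real.exp (a * ω) : ℂ) ^ k * expSeq θ (gam a ω) u k

theorem GeomBound.expDeltaSeq {a θ ω : ℝ} (hθ : 0 ≤ θ) (ha : 0 ≤ a) {u : ℕ → ℂ} {B r : ℝ}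
    (hr : 0 ≤ r) (hrγ : r * gam a ω < 1) (hu : GeomBound B r u) :
    GeomBound (B * (1 - r * gam a ω) ^ (-θ)) (cOf a ω r) (expDeltaSeq a θ ω u) := fun k => by
  rw [LaguerreOp.expDeltaSeq, norm_mul, norm_pow, Complex.norm_real,
    Real.norm_of_nonneg (by positivity)]
  calc _ ≤ Real.exp (a * ω) ^ k *
        (B * (1 - r * gam a ω) ^ (-θ) * (r * (1 - r * gam a ω)⁻¹) ^ k) := by
        gcongr
        exact hu.expSeq hθ (gam_nonneg ha ω) hr hrγ k
    _ = _ := by rw [cOf, mul_pow, mul_pow, mul_pow]; ring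

theorem expDeltaSeq_add {a θ ω : ℝ} (hθ : 0 ≤ θ) (ha : 0 ≤ a) {u v : ℕ → ℂ} {B B' r : ℝ}
    (hr : 0 ≤ r) (hrγ : r * gam a ω < 1) (hu : GeomBound B r u) (hv : GeomBound B' r v) :
    expDeltaSeq a θ ω (u + v) = expDeltaSeq a θ ω u + expDeltaSeq a θ ω v := by
  ext k
  rw [expDeltaSeq, expSeq_add hθ (gam_nonneg ha ω) hr hrγ hu hv]
  exact mul_add _ _ _

theorem expDeltaSeq_smul (a θ ω : ℝ) (s : ℂ) (u : ℕ → ℂ) :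
    expDeltaSeq a θ ω (s • u) = s • expDeltaSeq a θ ω u := by
  ext k
  rw [expDeltaSeq, expSeq_smul]
  exact mul_left_comm _ _ _

theorem withSeminorms_normFamily (a : ℝ) : WithSeminorms (normFamily a) := ⟨rfl⟩

theorem A.differentiable {b : ℝ} (f : A b) : Differentiable ℂ f.1 :=
  (f.2 (Classical.arbitrary (Idx b))).1

theorem A.ext_derivs {b : ℝ} {f g : A b} (h : derivs f = derivs g) : f = g :=
  Subtype.ext (derivs_injOn f.differentiable g.differentiable h)

theorem A.derivs_add {b : ℝ} (f g : A b) : derivs (f + g : A b) = derivs f + derivs g :=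
  LaguerreOp.derivs_add f.differentiable g.differentiable

theorem A.derivs_smul {b : ℝ} (s : ℂ) (f : A b) : derivs (s • f : A b) = s • derivs f :=
  LaguerreOp.derivs_smul s f.differentiable

theorem A.geomBound {b : ℝ} (f : A b) (r : Idx b) : GeomBound (normFamily b r f) r (derivs f) :=
  (f.2 r).geomBound r.2.1

theorem exists_geomBound_expDeltaSeq {θ ω a b : ℝ} (hθ : 0 ≤ θ) (ha : 0 ≤ a) (hb : 0 ≤ b)
    (hab : b * gam a ω < 1) (c : Idx (cOf a ω b)) :
    ∃ (r : Idx b) (K : ℝ), 0 ≤ K ∧ ∀ f : A b,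
      GeomBound (K * normFamily b r f) c (expDeltaSeq a θ ω (derivs f)) := by
  obtain ⟨r, hbr, hrγ, hrc⟩ := exists_cOf_lt hab c.2.2
  have hr : 0 < r := hb.trans_lt hbr
  have hK : 0 ≤ (1 - r * gam a ω) ^ (-θ) := Real.rpow_nonneg (by linarith) _
  refine ⟨⟨r, hr, hbr⟩, _, hK, fun f k => ?_⟩
  refine ((f.geomBound ⟨r, hr, hbr⟩).expDeltaSeq hθ ha hr.le hrγ k).trans ?_
  have := cOf_nonneg hr.le hrγ
  rw [mul_comm (normFamily b _ f)]
  gcongr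

theorem egf_expDeltaSeq_mem {θ ω a b : ℝ} (hθ : 0 ≤ θ) (ha : 0 ≤ a) (hb : 0 ≤ b)
    (hab : b * gam a ω < 1) (f : A b) :
    egf (expDeltaSeq a θ ω (derivs f)) ∈ ASub (cOf a ω b) := fun c => by
  obtain ⟨r, K, -, bound⟩ := exists_geomBound_expDeltaSeq hθ ha hb hab c
  exact GeomBound.memB c.2.1 (differentiable_egf (bound f)) ((derivs_egf (bound f)).symm ▸ bound f)

/-- The operator `exp (a Δ_{θ,ω}) : 𝓐_b → 𝓐_c` as a map. -/
def expDeltaFun {θ ω a b : ℝ} (hθ : 0 ≤ θ) (ha : 0 ≤ a) (hb : 0 ≤ b)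
    (hab : b * gam a ω < 1) (f : A b) : A (cOf a ω b) :=
  ⟨egf (expDeltaSeq a θ ω (derivs f)), egf_expDeltaSeq_mem hθ ha hb hab f⟩

theorem derivs_expDeltaFun {θ ω a b : ℝ} (hθ : 0 ≤ θ) (ha : 0 ≤ a) (hb : 0 ≤ b)
    (hab : b * gam a ω < 1) (f : A b) :
    derivs (expDeltaFun hθ ha hb hab f) = expDeltaSeq a θ ω (derivs f) := by
  obtain ⟨r, K, -, bound⟩ :=
    exists_geomBound_expDeltaSeq hθ ha hb hab (Classical.arbitrary (Idx (cOf a ω b)))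
  exact derivs_egf (bound f)

/-- The operator `exp (a Δ_{θ,ω}) : 𝓐_b → 𝓐_c` as a linear map. -/
def expDeltaLin {θ ω a b : ℝ} (hθ : 0 ≤ θ) (ha : 0 ≤ a) (hb : 0 ≤ b)
    (hab : b * gam a ω < 1) : A b →ₗ[ℂ] A (cOf a ω b) where
  toFun := expDeltaFun hθ ha hb hab
  map_add' f g := A.ext_derivs <| by
    obtain ⟨r, hbr, hrγ, -⟩ := exists_cOf_lt hab (lt_add_one (cOf a ω b))
    have hr : 0 < r := hb.trans_lt hbr
    simp only [A.derivs_add, derivs_expDeltaFun]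
    exact expDeltaSeq_add hθ ha hr.le hrγ (f.geomBound ⟨r, hr, hbr⟩) (g.geomBound ⟨r, hr, hbr⟩)
  map_smul' s f := A.ext_derivs <| by
    simp only [A.derivs_smul, derivs_expDeltaFun, expDeltaSeq_smul, RingHom.id_apply]

/-- The operator `exp (a Δ_{θ,ω}) : 𝓐_b → 𝓐_c`. -/
def expDelta {θ ω a b : ℝ} (hθ : 0 ≤ θ) (ha : 0 ≤ a) (hb : 0 ≤ b)
    (hab : b * gam a ω < 1) : A b →L[ℂ] A (cOf a ω b) where
  toLinearMap := expDeltaLin hθ ha hb hab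
  cont := by
    refine WithSeminorms.continuous_of_isBounded (withSeminorms_normFamily b)
      (withSeminorms_normFamily _) _ fun c => ?_
    obtain ⟨r, K, hK, bound⟩ := exists_geomBound_expDeltaSeq hθ ha hb hab c
    refine ⟨{r}, ⟨K, hK⟩, fun f => ?_⟩
    rw [Finset.sup_singleton]
    exact GeomBound.bNorm_le c.2.1 ((derivs_expDeltaFun hθ ha hb hab f).symm ▸ bound f)

theorem expDelta_apply {θ ω a b : ℝ} (hθ : 0 ≤ θ) (ha : 0 ≤ a) (hb : 0 ≤ b)
    (hab : b * gam a ω < 1) (f : A b) :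
    (expDelta hθ ha hb hab f).1 = egf (expDeltaSeq a θ ω (derivs f)) := rfl

/-! ### The exponential series -/

theorem differentiable_deriv {f : ℂ → ℂ} (hf : Differentiable ℂ f) : Differentiable ℂ (deriv f) :=
  fun _ => (hf.analyticAt _).deriv.differentiableAt

/-- The action of `Δ_{θ,ω}` on the sequence of derivatives at `0`. -/
def deltaSeq (θ ω : ℝ) (u : ℕ → ℂ) (m : ℕ) : ℂ := (θ + m) * u (m + 1) + ω * m * u m

theorem differentiable_Delta (θ ω : ℝ) {f : ℂ → ℂ} (hf : Differentiable ℂ f) :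
    Differentiable ℂ (Delta θ ω f) := by
  have hf' := differentiable_deriv hf
  have := differentiable_deriv hf'
  unfold Delta
  fun_prop

theorem derivs_Delta (θ ω : ℝ) {f : ℂ → ℂ} (hf : Differentiable ℂ f) :
    derivs (Delta θ ω f) = deltaSeq θ ω (derivs f) := by
  have hf' := differentiable_deriv hf
  have hf'' := differentiable_deriv hf'
  have diff_theta : Differentiable ℂ ((θ : ℂ) • deriv f) := hf'.const_smul _
  have diff_second : Differentiable ℂ fun z => z * deriv (deriv f) z := by fun_prop
  have diff_euler : Differentiable ℂ fun z => z * deriv f z := by fun_prop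
  have split : Delta θ ω f = ((θ : ℂ) • deriv f + fun z => z * deriv (deriv f) z) +
      (ω : ℂ) • fun z => z * deriv f z := funext fun z => by simp [Delta, mul_assoc]
  rw [split, derivs_add (diff_theta.add diff_second) (diff_euler.const_smul _),
    derivs_add diff_theta diff_second, derivs_smul _ hf', derivs_smul _ diff_euler,
    derivs_id_mul hf'', derivs_id_mul hf']
  simp only [derivs_deriv]
  ext m
  cases m with
  | zero => simp [deltaSeq, mulSeq]
  | succ m =>
    simp only [Pi.add_apply, Pi.smul_apply, smul_eq_mul, mulSeq, deltaSeq]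
    push_cast
    ring

theorem differentiable_iterate_Delta (θ ω : ℝ) {f : ℂ → ℂ} (hf : Differentiable ℂ f) (K : ℕ) :
    Differentiable ℂ ((Delta θ ω)^[K] f) := by
  induction K with
  | zero => exact hf
  | succ K ih => rw [Function.iterate_succ_apply']; exact differentiable_Delta θ ω ih

theorem derivs_iterate_Delta (θ ω : ℝ) {f : ℂ → ℂ} (hf : Differentiable ℂ f) (K : ℕ) :
    derivs ((Delta θ ω)^[K] f) = (deltaSeq θ ω)^[K] (derivs f) := by
  induction K with
  | zero => rfl
  | succ K ih =>
    rw [Function.iterate_succ_apply', Function.iterate_succ_apply', ← ih,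
      derivs_Delta θ ω (differentiable_iterate_Delta θ ω hf K)]

/-- The matrix of `Δ_{θ,ω} ^ K` on sequences of derivatives at `0`: `deltaCoeff θ ω K m j` is
the coefficient of `u (m + j)` in entry `m`. -/
def deltaCoeff (θ ω : ℝ) : ℕ → ℕ → ℕ → ℝ
  | 0, _, 0 => 1
  | 0, _, _ + 1 => 0
  | K + 1, m, 0 => ω * m * deltaCoeff θ ω K m 0
  | K + 1, m, j + 1 => (θ + m) * deltaCoeff θ ω K (m + 1) j + ω * m * deltaCoeff θ ω K m (j + 1)

theorem hasSum_deltaCoeff (θ ω : ℝ) (u : ℕ → ℂ) (K m : ℕ) :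
    HasSum (fun j => (deltaCoeff θ ω K m j : ℂ) * u (m + j)) ((deltaSeq θ ω)^[K] u m) := by
  induction K generalizing m with
  | zero =>
    convert! hasSum_single (f := fun j => (deltaCoeff θ ω 0 m j : ℂ) * u (m + j)) 0 ?_ using 1
    · simp [deltaCoeff]
    · intro j hj
      obtain ⟨j, rfl⟩ := Nat.exists_eq_succ_of_ne_zero hj
      simp [deltaCoeff]
  | succ K ih =>
    have raise := (ih (m + 1)).mul_left ((θ : ℂ) + m)
    have keep := ((hasSum_nat_add_iff' 1).2 (ih m)).mul_left ((ω : ℂ) * m)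
    rw [← hasSum_nat_add_iff' 1, Function.iterate_succ_apply']
    convert! raise.add keep using 1
    · ext j
      simp only [deltaCoeff, show m + 1 + j = m + (j + 1) by ring]
      push_cast
      ring
    · simp only [deltaSeq, deltaCoeff, range_one, sum_singleton, add_zero]
      push_cast
      ring

theorem abs_deltaCoeff_le {θ : ℝ} (hθ : 0 ≤ θ) (ω : ℝ) (K m j : ℕ) :
    |deltaCoeff θ ω K m j| ≤ deltaCoeff θ |ω| K m j := by
  induction K generalizing m j with
  | zero => cases j <;> simp [deltaCoeff]
  | succ K ih =>
    have keep_le (j : ℕ) : |ω * m * deltaCoeff θ ω K m j| ≤ |ω| * m * deltaCoeff θ |ω| K m j := by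
      rw [abs_mul, abs_mul, Nat.abs_cast]
      gcongr
      exact ih _ _
    cases j with
    | zero => exact keep_le 0
    | succ j =>
      refine (abs_add_le _ _).trans (add_le_add ?_ (keep_le _))
      rw [abs_mul, abs_of_nonneg (by positivity : 0 ≤ θ + m)]
      gcongr
      exact ih _ _

theorem deltaCoeff_nonneg {θ ω : ℝ} (hθ : 0 ≤ θ) (hω : 0 ≤ ω) (K m j : ℕ) :
    0 ≤ deltaCoeff θ ω K m j := by
  simpa only [abs_of_nonneg hω] using (abs_nonneg _).trans (abs_deltaCoeff_le hθ ω K m j)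

/-- The entire function of `a` extending `gam a ω`. -/
def gamC (ω : ℝ) (a : ℂ) : ℂ := if ω = 0 then a else (ω : ℂ)⁻¹ * (Complex.exp (a * ω) - 1)

theorem gamC_ofReal (ω a : ℝ) : gamC ω a = gam a ω := by
  unfold gamC gam
  split_ifs <;> simp

theorem gamC_zero (ω : ℝ) : gamC ω 0 = 0 := by simp [gamC]

theorem hasDerivAt_gamC (ω : ℝ) (a : ℂ) : HasDerivAt (gamC ω) (Complex.exp (a * ω)) a := by
  by_cases h : ω = 0
  · have gamC_eq : gamC ω = fun a => a := funext fun a => by simp [gamC, h]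
    rw [gamC_eq]
    simpa [h] using hasDerivAt_id' a
  · have gamC_eq : gamC ω = fun a => (ω : ℂ)⁻¹ * (Complex.exp (a * ω) - 1) :=
      funext fun a => by simp [gamC, h]
    have : (ω : ℂ) ≠ 0 := by exact_mod_cast h
    rw [gamC_eq]
    convert! ((((hasDerivAt_id' a).mul_const (ω : ℂ)).cexp).sub_const 1).const_mul (ω : ℂ)⁻¹ using 1
    field_simp

/-- The matrix of `exp (a Δ_{θ,ω})` on sequences of derivatives at `0`, as an entire function
of `a`. Its Taylor coefficients at `a = 0` are the matrices of the powers of `Δ_{θ,ω}`. -/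
def expCoeff (θ ω : ℝ) (m j : ℕ) (a : ℂ) : ℂ :=
  Complex.exp (a * ω) ^ m * (Ring.multichoose (θ + m) j : ℝ) * gamC ω a ^ j

theorem expCoeff_ofReal (θ ω : ℝ) (m j : ℕ) (a : ℝ) : expCoeff θ ω m j a =
    ((Real.exp (a * ω) ^ m * (Ring.multichoose (θ + m) j * gam a ω ^ j) : ℝ) : ℂ) := by
  rw [expCoeff, gamC_ofReal]
  push_cast
  ring

theorem hasDerivAt_expCoeff_zero (θ ω : ℝ) (m : ℕ) (a : ℂ) :
    HasDerivAt (expCoeff θ ω m 0) (ω * m * expCoeff θ ω m 0 a) a := by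
  have expCoeff_eq : expCoeff θ ω m 0 = (fun a => Complex.exp (a * ω)) ^ m :=
    funext fun a => by simp [expCoeff]
  rw [expCoeff_eq]
  convert! ((((hasDerivAt_id' a).mul_const (ω : ℂ)).cexp).pow m) using 1
  cases m with
  | zero => simp
  | succ m =>
    rw [Pi.pow_apply, Nat.add_sub_cancel]
    ring

theorem hasDerivAt_expCoeff_succ (θ ω : ℝ) (m j : ℕ) (a : ℂ) :
    HasDerivAt (expCoeff θ ω m (j + 1))
      ((θ + m) * expCoeff θ ω (m + 1) j a + ω * m * expCoeff θ ω m (j + 1) a) a := by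
  have expCoeff_eq : expCoeff θ ω m (j + 1) =
      (fun a => expCoeff θ ω m 0 a * (Ring.multichoose (θ + m) (j + 1) : ℝ)) * gamC ω ^ (j + 1) :=
    funext fun a => by simp [expCoeff]
  have recurrence : ((Ring.multichoose (θ + m) (j + 1) : ℝ) : ℂ) * (j + 1) =
      (θ + m) * (Ring.multichoose (θ + m + 1) j : ℝ) := by
    exact_mod_cast multichoose_succ_mul (θ + m) j
  rw [expCoeff_eq]
  convert! ((hasDerivAt_expCoeff_zero θ ω m a).mul_const _).mul
    ((hasDerivAt_gamC ω a).pow (j + 1)) using 1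
  simp only [expCoeff, Ring.multichoose_zero_right, pow_zero, Pi.mul_apply, Pi.pow_apply]
  push_cast
  simp only [← add_assoc]
  linear_combination (-(Complex.exp (a * ω) ^ (m + 1)) * gamC ω a ^ j) * recurrence

theorem differentiable_expCoeff (θ ω : ℝ) (m j : ℕ) : Differentiable ℂ (expCoeff θ ω m j) := by
  cases j with
  | zero => exact fun a => (hasDerivAt_expCoeff_zero θ ω m a).differentiableAt
  | succ j => exact fun a => (hasDerivAt_expCoeff_succ θ ω m j a).differentiableAt

theorem derivs_expCoeff (θ ω : ℝ) (m j : ℕ) :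
    derivs (expCoeff θ ω m j) = fun K => (deltaCoeff θ ω K m j : ℂ) := by
  have diff := differentiable_expCoeff θ ω
  ext K
  induction K generalizing m j with
  | zero => cases j <;> simp [derivs, expCoeff, deltaCoeff, gamC_zero]
  | succ K ih =>
    rw [← congrFun (derivs_deriv _) K]
    cases j with
    | zero =>
      have deriv_eq : deriv (expCoeff θ ω m 0) = ((ω : ℂ) * m) • expCoeff θ ω m 0 :=
        funext fun a => (hasDerivAt_expCoeff_zero θ ω m a).deriv
      rw [deriv_eq, derivs_smul _ (diff m 0), Pi.smul_apply, ih, deltaCoeff]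
      push_cast
      rfl
    | succ j =>
      have deriv_eq : deriv (expCoeff θ ω m (j + 1)) = ((θ : ℂ) + m) • expCoeff θ ω (m + 1) j +
          ((ω : ℂ) * m) • expCoeff θ ω m (j + 1) :=
        funext fun a => (hasDerivAt_expCoeff_succ θ ω m j a).deriv
      rw [deriv_eq, derivs_add ((diff _ _).const_smul _) ((diff _ _).const_smul _),
        derivs_smul _ (diff _ _), derivs_smul _ (diff _ _), Pi.add_apply, Pi.smul_apply,
        Pi.smul_apply, ih, ih, deltaCoeff]
      push_cast
      rfl

theorem hasSum_expCoeff (θ ω a : ℝ) (m j : ℕ) :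
    HasSum (fun K : ℕ => a ^ K / (K ! : ℝ) * deltaCoeff θ ω K m j)
      (Real.exp (a * ω) ^ m * (Ring.multichoose (θ + m) j * gam a ω ^ j)) := by
  rw [← Complex.hasSum_ofReal, ← expCoeff_ofReal]
  refine (hasSum_derivs (differentiable_expCoeff θ ω m j) a).congr_fun fun K => ?_
  rw [derivs_expCoeff]
  push_cast
  ring

/-- The term with index `((m, j), K)` of the triple series that arises from
`∑ K, a ^ K / K! • (Δ_{θ,ω} ^ K f) z` on expanding each `Δ_{θ,ω} ^ K f` in powers of `z` and each
Taylor coefficient of it in the derivatives `u` of `f` at `0`. -/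
def expDeltaTerm {𝕜 : Type*} [RCLike 𝕜] (a θ ω : ℝ) (u : ℕ → 𝕜) (z : 𝕜) (p : (ℕ × ℕ) × ℕ) : 𝕜 :=
  ((a ^ p.2 / (p.2 ! : ℝ) * deltaCoeff θ ω p.2 p.1.1 p.1.2 : ℝ) : 𝕜) *
    (u (p.1.1 + p.1.2) / (p.1.1 ! : 𝕜) * z ^ p.1.1)

theorem hasSum_expDeltaTerm_power {𝕜 : Type*} [RCLike 𝕜] (a θ ω : ℝ) (u : ℕ → 𝕜) (z : 𝕜)
    (m j : ℕ) :
    HasSum (fun K => expDeltaTerm a θ ω u z ((m, j), K))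
      (((Real.exp (a * ω) ^ m * (Ring.multichoose (θ + m) j * gam a ω ^ j) : ℝ) : 𝕜) *
        (u (m + j) / (m ! : 𝕜) * z ^ m)) :=
  ((RCLike.hasSum_ofReal 𝕜).2 (hasSum_expCoeff θ ω a m j)).mul_right _

theorem summable_expDeltaTerm_majorant {a θ ω B r R : ℝ} (hθ : 0 ≤ θ) (hω : 0 ≤ ω) (ha : 0 ≤ a)
    (hB : 0 ≤ B) (hr : 0 ≤ r) (hrγ : r * gam a ω < 1) (hR : 0 ≤ R) :
    Summable (expDeltaTerm a θ ω (fun k => B * r ^ k) R) := by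
  set M := expDeltaTerm a θ ω (fun k => B * r ^ k) R
  have M_nonneg : 0 ≤ M := fun p => by
    have := deltaCoeff_nonneg hθ hω p.2 p.1.1 p.1.2
    exact mul_nonneg (by simp only [RCLike.ofReal_real_eq_id, id]; positivity) (by positivity)
  have sum_power (m j : ℕ) := hasSum_expDeltaTerm_power a θ ω (fun k => B * r ^ k) R m j
  have sum_shift (m : ℕ) : HasSum (fun j => ∑' K, M ((m, j), K))
      (B * (1 - r * gam a ω) ^ (-θ) *
        ((Real.exp (a * ω) * (r * (1 - r * gam a ω)⁻¹) * R) ^ m / (m ! : ℝ))) := by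
    convert! (hasSum_expSeq_bound (θ := θ) (B := B) (gam_nonneg ha ω) hr hrγ m).mul_right
      (Real.exp (a * ω) ^ m / (m ! : ℝ) * R ^ m) using 1
    · ext j
      rw [(sum_power m j).tsum_eq, mul_pow, pow_add]
      simp only [RCLike.ofReal_real_eq_id, id]
      ring
    · rw [mul_pow, mul_pow]
      ring
  refine (summable_prod_of_nonneg M_nonneg).2 ⟨fun q => (sum_power q.1 q.2).summable, ?_⟩
  have M_tsum_nonneg : 0 ≤ fun q : ℕ × ℕ => ∑' K, M (q, K) :=
    fun q => tsum_nonneg fun K => M_nonneg _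
  refine (summable_prod_of_nonneg M_tsum_nonneg).2 ⟨fun m => (sum_shift m).summable, ?_⟩
  simp only [fun m => (sum_shift m).tsum_eq]
  exact (Real.summable_pow_div_factorial _).mul_left _

theorem norm_expDeltaTerm_le {a θ : ℝ} (hθ : 0 ≤ θ) (ha : 0 ≤ a) (ω : ℝ) {u : ℕ → ℂ} {B r : ℝ}
    (hu : GeomBound B r u) (z : ℂ) (p : (ℕ × ℕ) × ℕ) :
    ‖expDeltaTerm a θ ω u z p‖ ≤ expDeltaTerm a θ |ω| (fun k => B * r ^ k) ‖z‖ p := by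
  have coeff_le := abs_deltaCoeff_le hθ ω p.2 p.1.1 p.1.2
  have coeff_nonneg := deltaCoeff_nonneg hθ (abs_nonneg ω) p.2 p.1.1 p.1.2
  have u_le := hu (p.1.1 + p.1.2)
  simp only [expDeltaTerm, RCLike.ofReal_real_eq_id, id]
  rw [norm_mul, norm_mul, norm_div, norm_pow, Complex.norm_natCast, RCLike.norm_ofReal, abs_mul,
    abs_of_nonneg (by positivity : 0 ≤ a ^ p.2 / (p.2 ! : ℝ))]
  gcongr

theorem hasSum_expDeltaTerm {a θ ω : ℝ} {u : ℕ → ℂ} {z : ℂ}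
    (h : Summable (expDeltaTerm a θ ω u z)) :
    HasSum (expDeltaTerm a θ ω u z) (egf (expDeltaSeq a θ ω u) z) := by
  have sum_pairs := h.hasSum.prod_fiberwise fun q => hasSum_expDeltaTerm_power a θ ω u z q.1 q.2
  have sum_fiber := sum_pairs.prod_fiberwise fun m => (sum_pairs.summable.prod_factor m).hasSum
  convert! h.hasSum using 1
  rw [← sum_fiber.tsum_eq, egf]
  refine tsum_congr fun m => ?_
  rw [expDeltaSeq, expSeq, mul_div_right_comm, mul_assoc, ← tsum_mul_right, ← tsum_mul_left]
  refine tsum_congr fun j => ?_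
  simp only [Complex.coe_algebraMap]
  push_cast
  ring

theorem tsum_expDeltaTerm_slice {a θ ω : ℝ} {f : ℂ → ℂ} (hf : Differentiable ℂ f) {z : ℂ} {K : ℕ}
    (h : Summable fun q => expDeltaTerm a θ ω (derivs f) z (q, K)) :
    ∑' q, expDeltaTerm a θ ω (derivs f) z (q, K) =
      (a : ℂ) ^ K / (K ! : ℂ) * ((Delta θ ω)^[K] f) z := by
  have sum_rows := h.hasSum.prod_fiberwise (g := fun m => (a : ℂ) ^ K / (K ! : ℂ) *
      (derivs ((Delta θ ω)^[K] f) m / (m ! : ℂ) * z ^ m)) fun m => by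
    convert! (hasSum_deltaCoeff θ ω (derivs f) K m).mul_right
      ((a : ℂ) ^ K / (K ! : ℂ) / (m ! : ℂ) * z ^ m) using 1
    · ext j
      simp only [expDeltaTerm, Complex.coe_algebraMap]
      push_cast
      ring
    · rw [derivs_iterate_Delta θ ω hf]
      ring
  exact sum_rows.unique ((hasSum_derivs (differentiable_iterate_Delta θ ω hf K) z).mul_left _)

theorem iteratedDeriv_exp_mul_zero (a : ℝ) (k : ℕ) :
    iteratedDeriv k (fun z => Complex.exp (a * z)) 0 = (a : ℂ) ^ k := by
  simp [iteratedDeriv_cexp_const_mul]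

theorem hasSeries_egf_expDeltaSeq {θ ω a : ℝ} (hθ : 0 ≤ θ) (ha : 0 ≤ a) {f : ℂ → ℂ}
    (hf : Differentiable ℂ f) {B r : ℝ} (hr : 0 ≤ r) (hrγ : r * gam a |ω| < 1)
    (hu : GeomBound B r (derivs f)) :
    HasSeries (fun z => Complex.exp (a * z)) θ ω f (egf (expDeltaSeq a θ ω (derivs f))) := by
  intro z
  have summable_term : Summable (expDeltaTerm a θ ω (derivs f) z) := .of_norm_bounded
    (summable_expDeltaTerm_majorant hθ (abs_nonneg ω) ha hu.nonneg hr hrγ (norm_nonneg z))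
    (norm_expDeltaTerm_le hθ ha ω hu z)
  have sum_swapped := (Equiv.prodComm ℕ (ℕ × ℕ)).hasSum_iff.2 (hasSum_expDeltaTerm summable_term)
  refine sum_swapped.prod_fiberwise fun K => ?_
  have summable_slice : Summable fun q => expDeltaTerm a θ ω (derivs f) z (q, K) :=
    sum_swapped.summable.prod_factor K
  rw [iteratedDeriv_exp_mul_zero, ← tsum_expDeltaTerm_slice hf summable_slice]
  exact summable_slice.hasSum

/-! ### Polynomials with nonpositive roots -/

/-- The action of `1 + γ D` on the sequence of derivatives at `0`. -/
def addShift (γ : ℝ) (u : ℕ → ℂ) (k : ℕ) : ℂ := u k + γ * u (k + 1)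

theorem expSeq_add_one {θ γ : ℝ} (hθ : 0 ≤ θ) (hγ : 0 ≤ γ) {u : ℕ → ℂ} {B r : ℝ} (hr : 0 ≤ r)
    (hrγ : r * γ < 1) (hu : GeomBound B r u) :
    expSeq (θ + 1) γ u = addShift γ (expSeq θ γ u) := by
  ext k
  have sum_k := (hasSum_nat_add_iff' 1).2 (summable_expSeq hθ hγ hr hrγ hu k).hasSum
  have sum_succ := (summable_expSeq hθ hγ hr hrγ hu (k + 1)).hasSum.mul_left (γ : ℂ)
  refine HasSum.tsum_eq ((hasSum_nat_add_iff' 1).1 ?_)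
  convert! sum_k.add sum_succ using 1
  · ext j
    rw [add_right_comm, Ring.multichoose_succ_succ, show k + 1 + j = k + (j + 1) by ring]
    push_cast
    ring_nf
  · simp [addShift, expSeq]
    ring

theorem expSeq_mulSeq {θ γ : ℝ} (hθ : 0 ≤ θ) (hγ : 0 ≤ γ) {u : ℕ → ℂ} {B r : ℝ} (hr : 0 ≤ r)
    (hrγ : r * γ < 1) (hu : GeomBound B r u) :
    expSeq θ γ (mulSeq u) =
      mulSeq (expSeq (θ + 1 + 1) γ u) + (γ * θ : ℂ) • expSeq (θ + 1) γ u := by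
  have sum_w (k) := (summable_expSeq (by positivity : 0 ≤ θ + 1) hγ hr hrγ hu k).hasSum
  rw [expSeq_add_one (by positivity : 0 ≤ θ + 1) hγ hr hrγ hu]
  ext k
  cases k with
  | zero =>
    refine HasSum.tsum_eq ((hasSum_nat_add_iff' 1).1 ?_)
    convert! (sum_w 0).mul_left (γ * θ : ℂ) using 1
    · ext j
      have absorb : (Ring.multichoose θ (j + 1) * (j + 1) : ℂ) = θ * Ring.multichoose (θ + 1) j :=
        mod_cast multichoose_succ_mul θ j
      rw [zero_add, zero_add, mulSeq]
      push_cast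
      simp only [add_zero]
      linear_combination (γ ^ (j + 1) * u j : ℂ) * absorb
    · simp [mulSeq, expSeq]
  | succ k =>
    refine HasSum.tsum_eq ((hasSum_nat_add_iff' 1).1 ?_)
    have sum_k := (hasSum_nat_add_iff' 1).2 (sum_w k)
    convert! (sum_k.mul_left (k + 1 : ℂ)).add
      ((sum_w (k + 1)).mul_left (γ * (θ + k + 1) : ℂ)) using 1
    · ext j
      have absorb : (Ring.multichoose (θ + 1 + k) (j + 1) * (j + 1) : ℂ) =
          (θ + 1 + k) * Ring.multichoose (θ + 1 + k + 1) j :=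
        mod_cast multichoose_succ_mul (θ + 1 + k) j
      rw [show k + 1 + (j + 1) = k + (j + 1) + 1 by ring, mulSeq,
        show θ + ((k + 1 : ℕ) : ℝ) = θ + 1 + k by push_cast; ring,
        show θ + 1 + ((k + 1 : ℕ) : ℝ) = θ + 1 + k + 1 by push_cast; ring,
        show k + 1 + j = k + (j + 1) by ring]
      push_cast
      linear_combination (γ ^ (j + 1) * u (k + (j + 1)) : ℂ) * absorb
    · simp [mulSeq, addShift, expSeq]
      ring

/-- The derivatives at `0` of a polynomial. -/
def polySeq (p : ℂ[X]) (k : ℕ) : ℂ := (k ! : ℂ) * p.coeff k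

theorem exists_geomBound_polySeq (p : ℂ[X]) {r : ℝ} (hr : 0 < r) :
    ∃ B, GeomBound B r (polySeq p) := by
  refine ⟨∑ k ∈ range (p.natDegree + 1), ‖polySeq p k‖ / r ^ k, fun k => ?_⟩
  by_cases hk : k < p.natDegree + 1
  · rw [← div_le_iff₀ (by positivity)]
    exact single_le_sum (f := fun k => ‖polySeq p k‖ / r ^ k) (fun i _ => by positivity)
      (mem_range.2 hk)
  · rw [polySeq, coeff_eq_zero_of_natDegree_lt (by lia)]
    simp only [mul_zero, norm_zero]
    positivity

theorem egf_polySeq (p : ℂ[X]) : egf (polySeq p) = fun z => p.eval z := by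
  ext z
  rw [egf, tsum_eq_sum (s := range (p.natDegree + 1)), eval_eq_sum_range]
  · exact sum_congr rfl fun k _ => by simp [polySeq, Nat.factorial_ne_zero]
  · intro k hk
    rw [polySeq, coeff_eq_zero_of_natDegree_lt (by simpa using hk)]
    simp

theorem derivs_eval (p : ℂ[X]) : derivs (fun z => p.eval z) = polySeq p := by
  obtain ⟨B, hB⟩ := exists_geomBound_polySeq p one_pos
  rw [← egf_polySeq, derivs_egf hB]

theorem polySeq_add (p q : ℂ[X]) : polySeq (p + q) = polySeq p + polySeq q := by
  ext k
  simp [polySeq, mul_add]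

theorem polySeq_C_mul (s : ℂ) (p : ℂ[X]) : polySeq (C s * p) = s • polySeq p := by
  ext k
  simp [polySeq, mul_left_comm]

theorem polySeq_X_mul (p : ℂ[X]) : polySeq (X * p) = mulSeq (polySeq p) := by
  ext k
  cases k with
  | zero => simp [polySeq, mulSeq]
  | succ k =>
    simp only [polySeq, mulSeq, coeff_X_mul, Nat.factorial_succ]
    push_cast
    ring

/-- The polynomial `(1 + γ D) g`. -/
def oneAddDeriv (γ : ℝ) (g : ℂ[X]) : ℂ[X] := g + C (γ : ℂ) * derivative g

theorem polySeq_oneAddDeriv (γ : ℝ) (g : ℂ[X]) :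
    polySeq (oneAddDeriv γ g) = addShift γ (polySeq g) := by
  ext k
  simp only [oneAddDeriv, addShift, polySeq, coeff_add, coeff_C_mul, coeff_derivative,
    Nat.factorial_succ]
  push_cast
  ring

/-- The image of `(X + x) p` under `exp (γ (θ + zD) D)`, in terms of the image `g` of `p`. -/
def stepPoly (θ γ x : ℝ) (g : ℂ[X]) : ℂ[X] :=
  C (x : ℂ) * g + (X * oneAddDeriv γ (oneAddDeriv γ g) + C (γ * θ : ℂ) * oneAddDeriv γ g)

theorem expSeq_polySeq_X_add_C_mul {θ γ : ℝ} (hθ : 0 ≤ θ) (hγ : 0 ≤ γ) (x : ℝ) {p g : ℂ[X]}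
    (hpg : expSeq θ γ (polySeq p) = polySeq g) :
    expSeq θ γ (polySeq ((X + C (x : ℂ)) * p)) = polySeq (stepPoly θ γ x g) := by
  obtain ⟨r, hr, hrγ⟩ := exists_pos_mul_lt one_pos γ
  rw [mul_comm] at hrγ
  obtain ⟨B, hp⟩ := exists_geomBound_polySeq p hr
  obtain ⟨B₁, hXp⟩ := exists_geomBound_polySeq (X * p) hr
  obtain ⟨B₂, hxp⟩ := exists_geomBound_polySeq (C (x : ℂ) * p) hr
  have shift_one : expSeq (θ + 1) γ (polySeq p) = polySeq (oneAddDeriv γ g) := by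
    rw [expSeq_add_one hθ hγ hr.le hrγ hp, hpg, polySeq_oneAddDeriv]
  have shift_two : expSeq (θ + 1 + 1) γ (polySeq p) =
      polySeq (oneAddDeriv γ (oneAddDeriv γ g)) := by
    rw [expSeq_add_one (by positivity) hγ hr.le hrγ hp, shift_one, ← polySeq_oneAddDeriv]
  rw [add_mul, polySeq_add, add_comm, expSeq_add hθ hγ hr.le hrγ hxp hXp, polySeq_C_mul,
    expSeq_smul, polySeq_X_mul, expSeq_mulSeq hθ hγ hr.le hrγ hp, shift_one, shift_two, hpg,
    stepPoly, polySeq_add, polySeq_add, polySeq_C_mul, polySeq_C_mul, polySeq_X_mul]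

theorem expSeq_polySeq_one (θ γ : ℝ) : expSeq θ γ (polySeq 1) = polySeq 1 := by
  ext k
  rw [expSeq, tsum_eq_single 0]
  · simp
  · intro j hj
    simp [polySeq, coeff_one, hj]

theorem re_multisetSum_nonneg {s : Multiset ℂ} (hs : ∀ a ∈ s, 0 ≤ a.re) : 0 ≤ s.sum.re := by
  rw [← Complex.coe_reAddGroupHom, map_multiset_sum]
  exact Multiset.sum_nonneg (by simpa using hs)

theorem re_inv_nonneg {w : ℂ} (hw : 0 ≤ w.re) : 0 ≤ (w⁻¹).re := by
  rw [Complex.inv_re]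
  exact div_nonneg hw (Complex.normSq_nonneg w)

theorem exists_sq_eq_of_mem_slitPlane {z : ℂ} (hz : z ∈ Complex.slitPlane) :
    ∃ w : ℂ, w ^ 2 = z ∧ 0 < w.re := by
  obtain ⟨w, rfl⟩ := IsAlgClosed.exists_pow_nat_eq z two_pos
  rcases lt_trichotomy w.re 0 with neg | zero | pos
  · exact ⟨-w, neg_sq w, by simpa using neg⟩
  · rw [Complex.mem_slitPlane_iff, sq, Complex.mul_re, Complex.mul_im, zero] at hz
    exact absurd hz (by simp [mul_self_nonneg])
  · exact ⟨w, rfl, pos⟩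

theorem re_mul_inv_sq_sub_nonneg {w a : ℂ} (hw : 0 < w.re) (ha : a ∉ Complex.slitPlane) :
    0 ≤ (w * (w ^ 2 - a)⁻¹).re := by
  have hw0 : w ≠ 0 := fun h => by simp [h] at hw
  obtain ⟨ha_re, ha_im⟩ : a.re ≤ 0 ∧ a.im = 0 := by
    simpa [Complex.mem_slitPlane_iff] using ha
  have eq_inv : w * (w ^ 2 - a)⁻¹ = (w - a * w⁻¹)⁻¹ := by
    rw [show w - a * w⁻¹ = (w ^ 2 - a) * w⁻¹ by field_simp, mul_inv, inv_inv, mul_comm]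
  rw [eq_inv]
  refine re_inv_nonneg ?_
  rw [Complex.sub_re, Complex.mul_re, ha_im, zero_mul, sub_zero]
  linarith [mul_nonpos_of_nonpos_of_nonneg ha_re (re_inv_nonneg hw.le)]

/-- Nonzero polynomials all of whose roots lie in `(-∞, 0]`. -/
def NonposRooted (p : ℂ[X]) : Prop := ∀ z ∈ Complex.slitPlane, p.eval z ≠ 0

theorem NonposRooted.ne_zero {p : ℂ[X]} (hp : NonposRooted p) : p ≠ 0 :=
  fun h => hp 1 (by simp) (by simp [h])

theorem NonposRooted.notMem_slitPlane {p : ℂ[X]} (hp : NonposRooted p) {a : ℂ}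
    (ha : a ∈ p.roots) : a ∉ Complex.slitPlane := fun h => hp a h (isRoot_of_mem_roots ha)

theorem NonposRooted.mul {p q : ℂ[X]} (hp : NonposRooted p) (hq : NonposRooted q) :
    NonposRooted (p * q) := fun z hz => by
  rw [eval_mul]
  exact mul_ne_zero (hp z hz) (hq z hz)

theorem NonposRooted.re_mul_oneAddDeriv_div_pos {γ : ℝ} (hγ : 0 ≤ γ) {g : ℂ[X]}
    (hg : NonposRooted g) {w : ℂ} (hw : 0 < w.re) (hw2 : w ^ 2 ∈ Complex.slitPlane) :
    0 < (w * ((oneAddDeriv γ g).eval (w ^ 2) / g.eval (w ^ 2))).re := by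
  have hgw := hg _ hw2
  have expand : w * ((oneAddDeriv γ g).eval (w ^ 2) / g.eval (w ^ 2)) =
      w + γ * (g.roots.map fun a => w * (w ^ 2 - a)⁻¹).sum := by
    rw [Multiset.sum_map_mul_left, oneAddDeriv, eval_add, eval_mul, eval_C,
      (IsAlgClosed.splits g).eval_derivative_eq_eval_mul_sum hgw]
    simp only [one_div]
    field_simp
  rw [expand, Complex.add_re, Complex.re_ofReal_mul]
  refine add_pos_of_pos_of_nonneg hw (mul_nonneg hγ (re_multisetSum_nonneg fun b hb => ?_))
  obtain ⟨a, ha, rfl⟩ := Multiset.mem_map.1 hb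
  exact re_mul_inv_sq_sub_nonneg hw (hg.notMem_slitPlane ha)

theorem NonposRooted.oneAddDeriv {γ : ℝ} (hγ : 0 ≤ γ) {g : ℂ[X]} (hg : NonposRooted g) :
    NonposRooted (oneAddDeriv γ g) := fun z hz hz0 => by
  obtain ⟨w, rfl, hw⟩ := exists_sq_eq_of_mem_slitPlane hz
  simpa [hz0] using hg.re_mul_oneAddDeriv_div_pos hγ hw hz

/-- With `h = (1 + γ D) g` and `z = w²`, `Re w > 0`, the quotient of `stepPoly θ γ x g` by `w h` at
`z` is a sum of terms with nonnegative real part, one of them positive. -/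
theorem NonposRooted.stepPoly {θ γ x : ℝ} (hθ : 0 ≤ θ) (hγ : 0 ≤ γ) (hx : 0 ≤ x) {g : ℂ[X]}
    (hg : NonposRooted g) : NonposRooted (stepPoly θ γ x g) := fun z hz hz0 => by
  obtain ⟨w, rfl, hw⟩ := exists_sq_eq_of_mem_slitPlane hz
  have hw0 : w ≠ 0 := fun h => by simp [h] at hw
  have hh := hg.oneAddDeriv hγ
  set h := LaguerreOp.oneAddDeriv γ g with h_def
  have hhz := hh _ hz
  have first_pos := hg.re_mul_oneAddDeriv_div_pos hγ hw hz
  have second_pos := hh.re_mul_oneAddDeriv_div_pos hγ hw hz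
  have quotient : (LaguerreOp.stepPoly θ γ x g).eval (w ^ 2) / (w * h.eval (w ^ 2)) =
      (x : ℂ) * (w * (h.eval (w ^ 2) / g.eval (w ^ 2)))⁻¹ +
        w * ((LaguerreOp.oneAddDeriv γ h).eval (w ^ 2) / h.eval (w ^ 2)) +
        ((γ * θ : ℝ) : ℂ) * w⁻¹ := by
    simp only [LaguerreOp.stepPoly, ← h_def, eval_add, eval_mul, eval_C, eval_X]
    push_cast
    field_simp
    ring
  have quotient_re := congrArg Complex.re quotient
  rw [hz0, zero_div, Complex.zero_re, Complex.add_re, Complex.add_re, Complex.re_ofReal_mul,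
    Complex.re_ofReal_mul] at quotient_re
  have x_term := mul_nonneg hx (re_inv_nonneg first_pos.le)
  have θ_term := mul_nonneg (mul_nonneg hγ hθ) (re_inv_nonneg hw.le)
  linarith

theorem exists_nonposRooted_expSeq_prod {θ γ : ℝ} (hθ : 0 ≤ θ) (hγ : 0 ≤ γ) {s : Multiset ℂ}
    (hs : ∀ a ∈ s, a ∉ Complex.slitPlane) :
    ∃ g, NonposRooted g ∧ expSeq θ γ (polySeq (s.map fun a => X - C a).prod) = polySeq g := by
  induction s using Multiset.induction_on with
  | empty => exact ⟨1, by simp [NonposRooted], by simpa using expSeq_polySeq_one θ γ⟩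
  | cons a s ih =>
    obtain ⟨g, hg, image_eq⟩ := ih fun b hb => hs b (Multiset.mem_cons_of_mem hb)
    obtain ⟨ha_re, ha_im⟩ : a.re ≤ 0 ∧ a.im = 0 := by
      simpa [Complex.mem_slitPlane_iff] using hs a (Multiset.mem_cons_self a s)
    have factor_eq : (X - C a : ℂ[X]) = X + C ((-a.re : ℝ) : ℂ) := by
      rw [sub_eq_add_neg, ← C_neg]
      congr 2
      exact Complex.ext (by simp) (by simp [ha_im])
    refine ⟨_, hg.stepPoly hθ hγ (neg_nonneg.2 ha_re), ?_⟩
    rw [Multiset.map_cons, Multiset.prod_cons, factor_eq]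
    exact expSeq_polySeq_X_add_C_mul hθ hγ _ image_eq

theorem NonposRooted.exists_expSeq {θ γ : ℝ} (hθ : 0 ≤ θ) (hγ : 0 ≤ γ) {p : ℂ[X]}
    (hp : NonposRooted p) : ∃ g, NonposRooted g ∧ expSeq θ γ (polySeq p) = polySeq g := by
  obtain ⟨g, hg, image_eq⟩ :=
    exists_nonposRooted_expSeq_prod hθ hγ fun _ => hp.notMem_slitPlane
  have lead_ne : p.leadingCoeff ≠ 0 := leadingCoeff_ne_zero.2 hp.ne_zero
  refine ⟨C p.leadingCoeff * g, .mul (fun z _ => by simpa using lead_ne) hg, ?_⟩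
  rw [polySeq_C_mul, ← image_eq, ← expSeq_smul, ← polySeq_C_mul,
    ← (IsAlgClosed.splits p).eq_prod_roots]

/-! ### Limits of polynomials with nonpositive roots -/

/-- The elements of a multiset of nonnegative numbers in decreasing order, continued by zeros. -/
def sortedSeq (s : Multiset ℝ) (j : ℕ) : ℝ := (s.sort (· ≥ ·)).getD j 0

theorem sortedSeq_nonneg {s : Multiset ℝ} (hs : ∀ x ∈ s, 0 ≤ x) (j : ℕ) : 0 ≤ sortedSeq s j := by
  rw [sortedSeq]
  by_cases hj : j < (s.sort (· ≥ ·)).length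
  · rw [List.getD_eq_getElem _ _ hj]
    exact hs _ ((Multiset.mem_sort _).1 (List.getElem_mem hj))
  · rw [List.getD_eq_default _ _ (not_lt.1 hj)]

theorem antitone_sortedSeq {s : Multiset ℝ} (hs : ∀ x ∈ s, 0 ≤ x) : Antitone (sortedSeq s) := by
  intro i j hij
  by_cases hj : j < (s.sort (· ≥ ·)).length
  · rw [sortedSeq, sortedSeq, List.getD_eq_getElem _ _ hj,
      List.getD_eq_getElem _ _ (hij.trans_lt hj)]
    exact (Multiset.pairwise_sort s (· ≥ ·)).sortedGE.getElem_ge_getElem_of_le hij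
  · rw [sortedSeq, List.getD_eq_default _ _ (not_lt.1 hj)]
    exact sortedSeq_nonneg hs i

@[to_additive]
theorem prod_range_getD {α M : Type*} [CommMonoid M] (f : α → M) (L : List α) (a : α) :
    ∏ j ∈ range L.length, f (L.getD j a) = (L.map f).prod := by
  induction L with
  | nil => simp
  | cons b L ih => simp [prod_range_succ', ← ih, mul_comm]

@[to_additive]
theorem hasProd_sortedSeq {M : Type*} [CommMonoid M] [TopologicalSpace M] {f : ℝ → M}
    (hf : f 0 = 1) (s : Multiset ℝ) : HasProd (fun j => f (sortedSeq s j)) (s.map f).prod := by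
  have finite_prod : (s.map f).prod =
      ∏ j ∈ range (s.sort (· ≥ ·)).length, f (sortedSeq s j) := by
    simp only [sortedSeq]
    rw [prod_range_getD, ← Multiset.prod_coe, ← Multiset.map_coe, Multiset.sort_eq]
  rw [finite_prod]
  refine hasProd_prod_of_ne_finset_one fun j hj => ?_
  rw [sortedSeq, List.getD_eq_default _ _ (by simpa using hj), hf]

theorem NonposRooted.ofReal_neg_inv {p : ℂ[X]} (hp : NonposRooted p) {a : ℂ} (ha : a ∈ p.roots) :
    0 ≤ (-a⁻¹).re ∧ (((-a⁻¹).re : ℝ) : ℂ) = -a⁻¹ := by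
  obtain ⟨ha_re, ha_im⟩ : a.re ≤ 0 ∧ a.im = 0 := by
    simpa [Complex.mem_slitPlane_iff] using hp.notMem_slitPlane ha
  refine ⟨?_, Complex.ext rfl (by simp [ha_im])⟩
  rw [Complex.neg_re, Complex.inv_re, ← neg_div]
  exact div_nonneg (by linarith) (Complex.normSq_nonneg _)

/-- The numbers `-1 / a`, where `a` runs over the roots of `p`, in decreasing order: the parameters
`β_j` in `p(z) = p(0) ∏ (1 + β_j z)`. -/
def negInvRoots (p : ℂ[X]) : ℕ → ℝ := sortedSeq (p.roots.map fun a => (-a⁻¹).re)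

theorem NonposRooted.negInvRoots_nonneg {p : ℂ[X]} (hp : NonposRooted p) (j : ℕ) :
    0 ≤ negInvRoots p j :=
  sortedSeq_nonneg (Multiset.forall_mem_map_iff.2 fun _ ha => (hp.ofReal_neg_inv ha).1) j

theorem NonposRooted.antitone_negInvRoots {p : ℂ[X]} (hp : NonposRooted p) :
    Antitone (negInvRoots p) :=
  antitone_sortedSeq (Multiset.forall_mem_map_iff.2 fun _ ha => (hp.ofReal_neg_inv ha).1)

theorem summable_negInvRoots (p : ℂ[X]) : Summable (negInvRoots p) :=
  (hasSum_sortedSeq (f := id) rfl _).summable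

theorem NonposRooted.eval_eq {p : ℂ[X]} (hp : NonposRooted p) (h0 : p.eval 0 ≠ 0) (z : ℂ) :
    p.eval z = p.eval 0 * ∏' j, (1 + (negInvRoots p j : ℂ) * z) := by
  have split (w : ℂ) : p.eval w = p.leadingCoeff * (p.roots.map fun a => w - a).prod :=
    (IsAlgClosed.splits p).eval_eq_prod_roots w
  have prod_eq : HasProd (fun j => 1 + (negInvRoots p j : ℂ) * z) _ :=
    hasProd_sortedSeq (f := fun x : ℝ => 1 + (x : ℂ) * z) (by simp) _
  rw [prod_eq.tprod_eq, Multiset.map_map, split z, split 0, mul_assoc, ← Multiset.prod_map_mul]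
  congr 2
  refine Multiset.map_congr rfl fun a ha => ?_
  have ha0 : a ≠ 0 := by
    rintro rfl
    exact h0 (isRoot_of_mem_roots ha)
  simp only [Function.comp, (hp.ofReal_neg_inv ha).2]
  field_simp
  ring

theorem NonposRooted.eval_zero_derivative_eq {p : ℂ[X]} (hp : NonposRooted p)
    (h0 : p.eval 0 ≠ 0) :
    p.derivative.eval 0 = p.eval 0 * ((∑' j, negInvRoots p j : ℝ) : ℂ) := by
  have sum_eq : HasSum (fun j => (negInvRoots p j : ℂ)) _ :=
    hasSum_sortedSeq (f := fun x : ℝ => (x : ℂ)) (by simp) _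
  rw [(IsAlgClosed.splits p).eval_derivative_eq_eval_mul_sum h0, Complex.ofReal_tsum,
    sum_eq.tsum_eq, Multiset.map_map]
  congr 2
  refine Multiset.map_congr rfl fun a ha => ?_
  simp only [Function.comp, (hp.ofReal_neg_inv ha).2]
  rw [zero_sub, one_div, inv_neg]

theorem le_tsum_div_of_antitone {β : ℕ → ℝ} (hβ0 : ∀ j, 0 ≤ β j) (hβ : Antitone β)
    (hs : Summable β) (j : ℕ) : β j ≤ (∑' i, β i) / (j + 1) := by
  rw [le_div_iff₀ (by positivity)]
  calc β j * (j + 1) = ∑ _ ∈ range (j + 1), β j := by simp [mul_comm]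
    _ ≤ ∑ i ∈ range (j + 1), β i :=
      sum_le_sum fun _ hi => hβ (Nat.lt_succ_iff.1 (mem_range.1 hi))
    _ ≤ ∑' i, β i := hs.sum_le_tsum _ fun i _ => hβ0 i

theorem exists_subseq_tendsto_of_antitone {β : ℕ → ℕ → ℝ} (hβ0 : ∀ n j, 0 ≤ β n j)
    (hβ : ∀ n, Antitone (β n)) (hs : ∀ n, Summable (β n)) {σ : ℝ}
    (hσ : Tendsto (fun n => ∑' j, β n j) atTop (𝓝 σ)) :
    ∃ (τ : ℕ → ℕ) (b : ℕ → ℝ), StrictMono τ ∧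
      (∀ j, Tendsto (fun n => β (τ n) j) atTop (𝓝 (b j))) ∧
      (∀ j, 0 ≤ b j) ∧ Antitone b ∧ Summable b ∧ ∑' j, b j ≤ σ := by
  obtain ⟨S, hS⟩ := hσ.bddAbove_range
  have mem_Icc (n : ℕ) : β n ∈ Set.univ.pi fun _ : ℕ => Set.Icc (0 : ℝ) S := fun j _ =>
    ⟨hβ0 n j, ((hs n).le_tsum j fun i _ => hβ0 n i).trans (hS ⟨n, rfl⟩)⟩
  obtain ⟨b, -, τ, hτ, hlim⟩ :=
    (isCompact_univ_pi fun _ : ℕ => isCompact_Icc).tendsto_subseq mem_Icc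
  have hlim (j) : Tendsto (fun n => β (τ n) j) atTop (𝓝 (b j)) := tendsto_pi_nhds.1 hlim j
  have hb0 (j) : 0 ≤ b j := ge_of_tendsto' (hlim j) fun n => hβ0 _ j
  have partial_le (t : Finset ℕ) : ∑ j ∈ t, b j ≤ σ :=
    le_of_tendsto_of_tendsto' (tendsto_finsetSum t fun j _ => hlim j)
      (hσ.comp hτ.tendsto_atTop) fun n => (hs _).sum_le_tsum t fun j _ => hβ0 _ j
  have hbs := summable_of_sum_le hb0 partial_le
  exact ⟨τ, b, hτ, hlim, hb0,
    fun i j hij => le_of_tendsto_of_tendsto' (hlim j) (hlim i) fun n => hβ _ hij,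
    hbs, hbs.tsum_le_of_sum_le partial_le⟩

/-- The Weierstrass factor of genus one, with its zero normalised to `-1`. -/
def genusOneFactor (x : ℂ) : ℂ := (1 + x) * Complex.exp (-x)

theorem continuous_genusOneFactor : Continuous genusOneFactor := by
  unfold genusOneFactor
  fun_prop

theorem norm_genusOneFactor_sub_one_le (x : ℂ) :
    ‖genusOneFactor x - 1‖ ≤ ‖x‖ ^ 2 * Real.exp (2 * ‖x‖) := by
  have factor : genusOneFactor x - 1 = -(Complex.exp (-x) * (Complex.exp x - (1 + x))) := by
    rw [genusOneFactor, mul_sub, ← Complex.exp_add, neg_add_cancel, Complex.exp_zero]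
    ring
  have taylor : ‖Complex.exp x - (1 + x)‖ ≤ ‖x‖ ^ 2 * Real.exp ‖x‖ := by
    simpa [sum_range_succ] using Complex.norm_exp_sub_sum_le_norm_mul_exp x 2
  have exp_neg_le : ‖Complex.exp (-x)‖ ≤ Real.exp ‖x‖ := by
    simpa using Complex.norm_exp_le_exp_norm (-x)
  rw [factor, norm_neg, norm_mul]
  calc _ ≤ Real.exp ‖x‖ * (‖x‖ ^ 2 * Real.exp ‖x‖) := by gcongr
    _ = _ := by rw [two_mul, Real.exp_add]; ring

theorem tprod_genusOneFactor {b : ℕ → ℝ} (hb : Summable b) (z : ℂ) :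
    ∏' j, genusOneFactor (b j * z) =
      (∏' j, (1 + (b j : ℂ) * z)) * Complex.exp (-(((∑' j, b j : ℝ) : ℂ) * z)) := by
  have sum_mul : HasSum (fun j => (b j : ℂ) * z) (((∑' j, b j : ℝ) : ℂ) * z) :=
    (Complex.hasSum_ofReal.2 hb.hasSum).mul_right z
  have exp_prod := sum_mul.neg.cexp
  rw [← exp_prod.tprod_eq]
  exact (Complex.multipliable_one_add_of_summable sum_mul.summable).tprod_mul exp_prod.multipliable

/-- The genus one factors are what makes this work under a bound `S / (j + 1)`, which is not
summable: mass of `∑ β_j` may be lost in the limit, and reappears as an exponential factor. -/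
theorem tendsto_tprod_genusOneFactor {β : ℕ → ℕ → ℝ} {b : ℕ → ℝ} {S : ℝ}
    (hβ0 : ∀ n j, 0 ≤ β n j) (hβS : ∀ n j, β n j ≤ S / (j + 1))
    (hlim : ∀ j, Tendsto (fun n => β n j) atTop (𝓝 (b j))) (z : ℂ) :
    Tendsto (fun n => ∏' j, genusOneFactor (β n j * z)) atTop
      (𝓝 (∏' j, genusOneFactor (b j * z))) := by
  have hS : 0 ≤ S := by simpa using (hβ0 0 0).trans (hβS 0 0)
  have bound (n j : ℕ) : ‖genusOneFactor (β n j * z) - 1‖ ≤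
      (S * ‖z‖) ^ 2 * Real.exp (2 * (S * ‖z‖)) * (1 / ((j + 1 : ℕ) : ℝ) ^ 2) := by
    have norm_eq : ‖(β n j : ℂ) * z‖ = β n j * ‖z‖ := by
      rw [norm_mul, Complex.norm_real, Real.norm_of_nonneg (hβ0 n j)]
    have β_nonneg := hβ0 n j
    have div_le : S / (j + 1) ≤ S :=
      div_le_self hS (by linarith [(Nat.cast_nonneg j : (0 : ℝ) ≤ j)])
    calc _ ≤ (β n j * ‖z‖) ^ 2 * Real.exp (2 * (β n j * ‖z‖)) :=
          norm_eq ▸ norm_genusOneFactor_sub_one_le _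
      _ ≤ (S / (j + 1) * ‖z‖) ^ 2 * Real.exp (2 * (S * ‖z‖)) := by
        gcongr
        · exact hβS n j
        · exact (hβS n j).trans div_le
      _ = _ := by push_cast; field_simp
  have factor_lim (j : ℕ) : Tendsto (fun n => genusOneFactor (β n j * z) - 1) atTop
      (𝓝 (genusOneFactor (b j * z) - 1)) :=
    ((continuous_genusOneFactor.tendsto _).comp
      (((Complex.continuous_ofReal.tendsto _).comp (hlim j)).mul_const z)).sub_const 1
  have bound_summable := ((summable_nat_add_iff 1).2
    (Real.summable_one_div_nat_pow.2 one_lt_two)).mul_left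
      ((S * ‖z‖) ^ 2 * Real.exp (2 * (S * ‖z‖)))
  simpa only [add_sub_cancel] using tendsto_tprod_one_add_of_dominated_convergence
    bound_summable factor_lim (Eventually.of_forall bound)

theorem isLaguerre_of_tendsto_tprod {β : ℕ → ℕ → ℝ} (hβ0 : ∀ n j, 0 ≤ β n j)
    (hβ : ∀ n, Antitone (β n)) (hs : ∀ n, Summable (β n)) {σ : ℝ}
    (hσ : Tendsto (fun n => ∑' j, β n j) atTop (𝓝 σ)) {c : ℕ → ℂ} {F : ℂ → ℂ}
    (hF : ∀ z, Tendsto (fun n => c n * ∏' j, (1 + (β n j : ℂ) * z)) atTop (𝓝 (F z))) :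
    IsLaguerre F := by
  obtain ⟨τ, b, hτ, hlim, hb0, hb, hbs, hbσ⟩ := exists_subseq_tendsto_of_antitone hβ0 hβ hs hσ
  obtain ⟨S, hS⟩ := hσ.bddAbove_range
  have hβS (n j : ℕ) : β n j ≤ S / (j + 1) := by
    refine (le_tsum_div_of_antitone (hβ0 n) (hβ n) (hs n) j).trans ?_
    gcongr
    exact hS ⟨n, rfl⟩
  refine ⟨F 0, 0, σ - ∑' j, b j, b, sub_nonneg.2 hbσ, hb0, hb, hbs, fun z => ?_⟩
  have hc : Tendsto c atTop (𝓝 (F 0)) := by simpa using hF 0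
  have hσz : Tendsto (fun n => Complex.exp (-(((∑' j, β n j : ℝ) : ℂ) * z))) atTop
      (𝓝 (Complex.exp (-((σ : ℂ) * z)))) :=
    (((Complex.continuous_ofReal.tendsto _).comp hσ).mul_const z).neg.cexp
  have genusOne_lim := (hc.comp hτ.tendsto_atTop).mul
    (tendsto_tprod_genusOneFactor (fun n => hβ0 (τ n)) (fun n => hβS (τ n)) hlim z)
  have genusOne_eq := tendsto_nhds_unique genusOne_lim <|
    (((hF z).mul hσz).comp hτ.tendsto_atTop).congr fun n => by
      simp only [Function.comp_apply, tprod_genusOneFactor (hs (τ n)), mul_assoc]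
  rw [tprod_genusOneFactor hbs] at genusOne_eq
  have exp_cancel : Complex.exp (-((σ : ℂ) * z)) * Complex.exp ((σ : ℂ) * z) = 1 := by
    rw [← Complex.exp_add, neg_add_cancel, Complex.exp_zero]
  have exp_split : Complex.exp (((σ - ∑' j, b j : ℝ) : ℂ) * z) =
      Complex.exp ((σ : ℂ) * z) * Complex.exp (-(((∑' j, b j : ℝ) : ℂ) * z)) := by
    rw [← Complex.exp_add]
    push_cast
    ring_nf
  rw [exp_split, pow_zero, mul_one]
  linear_combination -F z * exp_cancel - Complex.exp ((σ : ℂ) * z) * genusOne_eq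

theorem isLaguerre_of_tendsto_eval {q : ℕ → ℂ[X]} (hq : ∀ n, NonposRooted (q n)) {F : ℂ → ℂ}
    (hF : ∀ z, Tendsto (fun n => (q n).eval z) atTop (𝓝 (F z))) {D : ℂ}
    (hD : Tendsto (fun n => (q n).derivative.eval 0) atTop (𝓝 D)) (hF0 : F 0 ≠ 0) :
    IsLaguerre F := by
  obtain ⟨N, hN⟩ := eventually_atTop.1 ((hF 0).eventually_ne hF0)
  have eval_ne (n : ℕ) : (q (n + N)).eval 0 ≠ 0 := hN _ (Nat.le_add_left _ _)
  have hF' (z) := (tendsto_add_atTop_iff_nat N).2 (hF z)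
  refine isLaguerre_of_tendsto_tprod (β := fun n => negInvRoots (q (n + N)))
    (c := fun n => (q (n + N)).eval 0) (σ := (D / F 0).re)
    (fun n => (hq _).negInvRoots_nonneg) (fun n => (hq _).antitone_negInvRoots)
    (fun n => summable_negInvRoots _) ?_
    fun z => (hF' z).congr fun n => (hq _).eval_eq (eval_ne n) z
  refine ((Complex.continuous_re.tendsto _).comp
    (((tendsto_add_atTop_iff_nat N).2 hD).div (hF' 0) hF0)).congr fun n => ?_
  rw [Function.comp_apply, Pi.div_apply, (hq _).eval_zero_derivative_eq (eval_ne n),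
    mul_div_cancel_left₀ _ (eval_ne n), Complex.ofReal_re]

/-! ### Approximation of Laguerre entire functions -/

theorem derivs_eq_circleIntegral {f : ℂ → ℂ} (hf : Differentiable ℂ f) (k : ℕ) :
    derivs f k = (2 * Real.pi * Complex.I / (k ! : ℂ))⁻¹ *
      ∮ z in C(0, 1), (1 / (z - 0) ^ (k + 1)) • f z := by
  rw [DiffContOnCl.circleIntegral_one_div_sub_center_pow_smul one_pos k hf.diffContOnCl,
    smul_eq_mul, inv_mul_cancel_left₀ (by simp [Nat.factorial_ne_zero, Real.pi_ne_zero]), derivs]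

theorem tendsto_derivs_of_tendsto {g : ℕ → ℂ → ℂ} {f : ℂ → ℂ}
    (hg : ∀ n, Differentiable ℂ (g n)) (hf : Differentiable ℂ f)
    (hlim : ∀ z, Tendsto (fun n => g n z) atTop (𝓝 (f z))) {M : ℝ}
    (hM : ∀ n z, ‖z‖ = 1 → ‖g n z‖ ≤ M) (k : ℕ) :
    Tendsto (fun n => derivs (g n) k) atTop (𝓝 (derivs f k)) := by
  simp only [derivs_eq_circleIntegral (hg _), derivs_eq_circleIntegral hf, circleIntegral]
  refine (intervalIntegral.tendsto_integral_filter_of_dominated_convergence (fun _ => M)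
    (Eventually.of_forall fun n => ?_) (Eventually.of_forall fun n => ?_)
    intervalIntegrable_const ?_).const_mul _
  · have circle_cont : Continuous (circleMap 0 1) := continuous_circleMap 0 1
    have kernel_cont : Continuous fun t => (circleMap 0 1 t ^ (k + 1))⁻¹ :=
      (circle_cont.pow _).inv₀ fun t => pow_ne_zero _ (circleMap_ne_center one_ne_zero)
    simp only [deriv_circleMap, sub_zero, one_div]
    exact ((circle_cont.mul continuous_const).smul
      (kernel_cont.smul ((hg n).continuous.comp circle_cont))).aestronglyMeasurable
  · refine Eventually.of_forall fun t _ => ?_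
    have norm_eq : ‖circleMap 0 1 t‖ = 1 := by simp
    simpa [deriv_circleMap, norm_eq] using hM n _ norm_eq
  · exact Eventually.of_forall fun t _ => ((hlim _).const_smul _).const_smul _

section limits

variable {B r : ℝ} {u : ℕ → ℕ → ℂ} {v : ℕ → ℂ}

theorem tendsto_expSeq {θ γ : ℝ} (hθ : 0 ≤ θ) (hγ : 0 ≤ γ) (hr : 0 ≤ r) (hrγ : r * γ < 1)
    (hu : ∀ n, GeomBound B r (u n)) (hlim : ∀ k, Tendsto (fun n => u n k) atTop (𝓝 (v k)))
    (k : ℕ) : Tendsto (fun n => expSeq θ γ (u n) k) atTop (𝓝 (expSeq θ γ v k)) :=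
  tendsto_tsum_of_dominated_convergence (hasSum_expSeq_bound hγ hr hrγ k).summable
    (fun j => (hlim (k + j)).const_mul _)
    (Eventually.of_forall fun n j => norm_expSeq_term_le hθ hγ (hu n) k j)

theorem tendsto_egf (hu : ∀ n, GeomBound B r (u n))
    (hlim : ∀ k, Tendsto (fun n => u n k) atTop (𝓝 (v k))) (z : ℂ) :
    Tendsto (fun n => egf (u n) z) atTop (𝓝 (egf v z)) :=
  tendsto_tsum_of_dominated_convergence (summable_egf_bound B r ‖z‖)
    (fun k => ((hlim k).div_const _).mul_const _)
    (Eventually.of_forall fun n k => norm_egf_term_le (hu n) le_rfl k)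

end limits

section nonnegCoeff

open scoped ComplexOrder

/-- The polynomials with nonnegative real coefficients; `q - p ∈ nonnegCoeff` is the coefficientwise
comparison of `p` and `q`. -/
def nonnegCoeff : Subsemiring ℂ[X] where
  carrier := {p | ∀ k, 0 ≤ p.coeff k}
  zero_mem' _ := by simp
  one_mem' k := by rw [coeff_one]; split_ifs <;> simp
  add_mem' hp hq k := by rw [coeff_add]; exact add_nonneg (hp k) (hq k)
  mul_mem' hp hq k := by
    rw [coeff_mul]
    exact sum_nonneg fun x _ => mul_nonneg (hp _) (hq _)

theorem X_mem_nonnegCoeff : X ∈ nonnegCoeff := fun k => by rw [coeff_X]; split_ifs <;> simp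

theorem C_ofReal_mem_nonnegCoeff {x : ℝ} (hx : 0 ≤ x) : C (x : ℂ) ∈ nonnegCoeff := fun k => by
  rw [coeff_C]
  split_ifs
  · exact_mod_cast hx
  · exact le_rfl

theorem C_mul_X_mem_nonnegCoeff {x : ℝ} (hx : 0 ≤ x) : C (x : ℂ) * X ∈ nonnegCoeff :=
  mul_mem (C_ofReal_mem_nonnegCoeff hx) X_mem_nonnegCoeff

theorem one_add_mem_nonnegCoeff {x : ℝ} (hx : 0 ≤ x) : 1 + C (x : ℂ) * X ∈ nonnegCoeff :=
  add_mem (one_mem _) (C_mul_X_mem_nonnegCoeff hx)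

theorem pow_sub_pow_mem_nonnegCoeff {p q : ℂ[X]} (hp : p ∈ nonnegCoeff) (hq : q ∈ nonnegCoeff)
    (hpq : q - p ∈ nonnegCoeff) (n : ℕ) : q ^ n - p ^ n ∈ nonnegCoeff := by
  rw [← geom_sum₂_mul]
  exact mul_mem (sum_mem fun i _ => mul_mem (pow_mem hq _) (pow_mem hp _)) hpq

theorem polySeq_nonneg {p : ℂ[X]} (hp : p ∈ nonnegCoeff) (k : ℕ) : 0 ≤ polySeq p k :=
  mul_nonneg (Nat.cast_nonneg _) (hp k)

theorem polySeq_le {p q : ℂ[X]} (hpq : q - p ∈ nonnegCoeff) (k : ℕ) :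
    polySeq p k ≤ polySeq q k :=
  mul_le_mul_of_nonneg_left (sub_nonneg.1 (coeff_sub q p k ▸ hpq k)) (Nat.cast_nonneg _)

theorem norm_eval_le_norm_eval_one {p : ℂ[X]} (hp : p ∈ nonnegCoeff) {z : ℂ} (hz : ‖z‖ = 1) :
    ‖p.eval z‖ ≤ ‖p.eval 1‖ := by
  have eval_one : p.eval 1 = ((∑ k ∈ range (p.natDegree + 1), ‖p.coeff k‖ : ℝ) : ℂ) := by
    rw [eval_eq_sum_range, Complex.ofReal_sum]
    exact sum_congr rfl fun k _ => by
      rw [one_pow, mul_one, ← Complex.eq_coe_norm_of_nonneg (hp k)]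
  rw [eval_one, Complex.norm_real, Real.norm_of_nonneg (by positivity), eval_eq_sum_range]
  refine (norm_sum_le _ _).trans (sum_le_sum fun k _ => ?_)
  rw [norm_mul, norm_pow, hz, one_pow, mul_one]

end nonnegCoeff

theorem nonposRooted_one : NonposRooted 1 := fun z _ => by simp

theorem NonposRooted.pow {p : ℂ[X]} (hp : NonposRooted p) (n : ℕ) : NonposRooted (p ^ n) :=
  fun z hz => by
    rw [eval_pow]
    exact pow_ne_zero n (hp z hz)

theorem nonposRooted_X : NonposRooted X := fun z hz => by
  simpa using Complex.slitPlane_ne_zero hz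

theorem nonposRooted_one_add {x : ℝ} (hx : 0 ≤ x) : NonposRooted (1 + C (x : ℂ) * X) := by
  intro z hz h
  simp only [eval_add, eval_one, eval_mul, eval_C, eval_X] at h
  have re_eq : 1 + x * z.re = 0 := by simpa using congrArg Complex.re h
  have im_eq : x * z.im = 0 := by simpa using congrArg Complex.im h
  have hx0 : x ≠ 0 := by
    rintro rfl
    simp at re_eq
  rcases Complex.mem_slitPlane_iff.1 hz with z_re_pos | z_im_ne
  · nlinarith
  · exact z_im_ne ((mul_eq_zero.1 im_eq).resolve_left hx0)

/-- The Laguerre entire function with parameters `m`, `α`, `β` and leading constant `C = 1`. -/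
def laguerreFun (m : ℕ) (α : ℝ) (β : ℕ → ℝ) (z : ℂ) : ℂ :=
  z ^ m * Complex.exp (α * z) * ∏' j, (1 + (β j : ℂ) * z)

/-- Polynomials approximating `laguerreFun m α β`. The exponent `2 ^ n` is used because
`(1 + α z / 2 ^ n) ^ 2 ^ n` increases with `n` coefficientwise, simply by squaring. -/
def laguerrePoly (m : ℕ) (α : ℝ) (β : ℕ → ℝ) (n : ℕ) : ℂ[X] :=
  X ^ m * (1 + C ((α / 2 ^ n : ℝ) : ℂ) * X) ^ 2 ^ n * ∏ j ∈ range n, (1 + C (β j : ℂ) * X)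

theorem differentiable_laguerreFun (m : ℕ) (α : ℝ) {β : ℕ → ℝ} (hβs : Summable β) :
    Differentiable ℂ (laguerreFun m α β) := by
  suffices Differentiable ℂ fun z : ℂ => ∏' j, (1 + (β j : ℂ) * z) by
    unfold laguerreFun
    fun_prop
  intro z
  have prod_converges := Summable.hasProdLocallyUniformlyOn_nat_one_add (R := ℂ)
    (f := fun j (w : ℂ) => (β j : ℂ) * w) (K := Metric.ball 0 (‖z‖ + 1)) Metric.isOpen_ball
    (hβs.abs.mul_right (‖z‖ + 1)) (Eventually.of_forall fun j w hw => by
      rw [norm_mul, Complex.norm_real, Real.norm_eq_abs]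
      have : ‖w‖ ≤ ‖z‖ + 1 := (mem_ball_zero_iff.1 hw).le
      gcongr)
    fun j => by fun_prop
  refine (prod_converges.tendstoLocallyUniformlyOn_finsetRange.differentiableOn
    (Eventually.of_forall fun n => ?_) Metric.isOpen_ball).differentiableAt
    (Metric.isOpen_ball.mem_nhds (by simp))
  fun_prop

theorem tendsto_eval_laguerrePoly (m : ℕ) (α : ℝ) {β : ℕ → ℝ} (hβs : Summable β) (z : ℂ) :
    Tendsto (fun n => (laguerrePoly m α β n).eval z) atTop (𝓝 (laguerreFun m α β z)) := by
  have eval_eq (n : ℕ) : (laguerrePoly m α β n).eval z =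
      z ^ m * (1 + (α : ℂ) * z / (2 ^ n : ℕ)) ^ 2 ^ n * ∏ j ∈ range n, (1 + (β j : ℂ) * z) := by
    simp [laguerrePoly, eval_prod, div_mul_eq_mul_div]
  have exp_lim := (Complex.tendsto_one_add_div_pow_exp (α * z)).comp
    (tendsto_pow_atTop_atTop_of_one_lt (one_lt_two (α := ℕ)))
  have prod_lim : Tendsto (fun n => ∏ j ∈ range n, (1 + (β j : ℂ) * z)) atTop
      (𝓝 (∏' j, (1 + (β j : ℂ) * z))) :=
    (Complex.multipliable_one_add_of_summable
      ((Complex.hasSum_ofReal.2 hβs.hasSum).mul_right z).summable).hasProd.tendsto_prod_nat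
  simp only [eval_eq]
  exact (exp_lim.const_mul _).mul prod_lim

section laguerrePoly

variable {α : ℝ} {β : ℕ → ℝ}

theorem nonposRooted_laguerrePoly (m : ℕ) (hα : 0 ≤ α) (hβ : ∀ j, 0 ≤ β j) (n : ℕ) :
    NonposRooted (laguerrePoly m α β n) :=
  ((nonposRooted_X.pow m).mul ((nonposRooted_one_add (by positivity)).pow _)).mul
    (prod_induction _ _ (fun _ _ => NonposRooted.mul) nonposRooted_one
      fun j _ => nonposRooted_one_add (hβ j))

theorem laguerrePoly_mem_nonnegCoeff (m : ℕ) (hα : 0 ≤ α) (hβ : ∀ j, 0 ≤ β j) (n : ℕ) :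
    laguerrePoly m α β n ∈ nonnegCoeff :=
  mul_mem (mul_mem (pow_mem X_mem_nonnegCoeff m)
    (pow_mem (one_add_mem_nonnegCoeff (by positivity)) _))
    (prod_mem fun j _ => one_add_mem_nonnegCoeff (hβ j))

theorem laguerrePoly_succ_sub_mem_nonnegCoeff (m : ℕ) (hα : 0 ≤ α) (hβ : ∀ j, 0 ≤ β j) (n : ℕ) :
    laguerrePoly m α β (n + 1) - laguerrePoly m α β n ∈ nonnegCoeff := by
  set x : ℝ := α / 2 ^ (n + 1) with hx_def
  have hx : 0 ≤ x := by positivity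
  set P : ℂ[X] := ∏ j ∈ range n, (1 + C (β j : ℂ) * X)
  have hP : P ∈ nonnegCoeff := prod_mem fun j _ => one_add_mem_nonnegCoeff (hβ j)
  have two_x : α / 2 ^ n = 2 * x := by rw [hx_def, pow_succ]; ring
  have h2x : 1 + C ((2 * x : ℝ) : ℂ) * X ∈ nonnegCoeff := one_add_mem_nonnegCoeff (by positivity)
  have sq_sub : (1 + C (x : ℂ) * X) ^ 2 - (1 + C ((2 * x : ℝ) : ℂ) * X) ∈ nonnegCoeff := by
    convert! pow_mem (C_mul_X_mem_nonnegCoeff hx) 2 using 1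
    push_cast
    simp only [map_mul, map_ofNat]
    ring
  have pow_sub := pow_sub_pow_mem_nonnegCoeff h2x
    (pow_mem (one_add_mem_nonnegCoeff hx) 2) sq_sub (2 ^ n)
  have split : laguerrePoly m α β (n + 1) - laguerrePoly m α β n = X ^ m *
      (((1 + C (x : ℂ) * X) ^ 2) ^ 2 ^ n - (1 + C ((2 * x : ℝ) : ℂ) * X) ^ 2 ^ n) *
        (P * (1 + C (β n : ℂ) * X)) +
      X ^ m * (1 + C ((2 * x : ℝ) : ℂ) * X) ^ 2 ^ n * (P * (C (β n : ℂ) * X)) := by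
    rw [laguerrePoly, laguerrePoly, ← hx_def, two_x, prod_range_succ, ← pow_mul, ← pow_succ']
    ring
  have hX : (X : ℂ[X]) ^ m ∈ nonnegCoeff := pow_mem X_mem_nonnegCoeff m
  rw [split]
  exact add_mem (mul_mem (mul_mem hX pow_sub) (mul_mem hP (one_add_mem_nonnegCoeff (hβ n))))
    (mul_mem (mul_mem hX (pow_mem h2x _)) (mul_mem hP (C_mul_X_mem_nonnegCoeff (hβ n))))

theorem tendsto_polySeq_laguerrePoly (m : ℕ) (hα : 0 ≤ α) (hβ : ∀ j, 0 ≤ β j)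
    (hβs : Summable β) (k : ℕ) : Tendsto (fun n => polySeq (laguerrePoly m α β n) k) atTop
      (𝓝 (derivs (laguerreFun m α β) k)) := by
  obtain ⟨M, hM⟩ := (tendsto_eval_laguerrePoly m α hβs 1).norm.bddAbove_range
  simp only [← derivs_eval]
  refine tendsto_derivs_of_tendsto (M := M) (fun n => (laguerrePoly m α β n).differentiable)
    (differentiable_laguerreFun m α hβs) (tendsto_eval_laguerrePoly m α hβs) (fun n z hz => ?_) k
  exact (norm_eval_le_norm_eval_one (laguerrePoly_mem_nonnegCoeff m hα hβ n) hz).trans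
    (hM ⟨n, rfl⟩)

open scoped ComplexOrder

theorem polySeq_laguerrePoly_le (m : ℕ) (hα : 0 ≤ α) (hβ : ∀ j, 0 ≤ β j) (hβs : Summable β)
    (n k : ℕ) : polySeq (laguerrePoly m α β n) k ≤ derivs (laguerreFun m α β) k :=
  (monotone_nat_of_le_succ fun n => polySeq_le
    (laguerrePoly_succ_sub_mem_nonnegCoeff m hα hβ n) k).ge_of_tendsto
    (tendsto_polySeq_laguerrePoly m hα hβ hβs k) n

theorem derivs_laguerreFun_nonneg (m : ℕ) (hα : 0 ≤ α) (hβ : ∀ j, 0 ≤ β j) (hβs : Summable β)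
    (k : ℕ) : 0 ≤ derivs (laguerreFun m α β) k :=
  (polySeq_nonneg (laguerrePoly_mem_nonnegCoeff m hα hβ 0) k).trans
    (polySeq_laguerrePoly_le m hα hβ hβs 0 k)

theorem geomBound_polySeq_laguerrePoly {m : ℕ} (hα : 0 ≤ α) (hβ : ∀ j, 0 ≤ β j)
    (hβs : Summable β) {B r : ℝ} (hf : GeomBound B r (derivs (laguerreFun m α β))) (n : ℕ) :
    GeomBound B r (polySeq (laguerrePoly m α β n)) := fun k =>
  (CStarAlgebra.norm_le_norm_of_nonneg_of_le
    (polySeq_nonneg (laguerrePoly_mem_nonnegCoeff m hα hβ n) k)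
    (polySeq_laguerrePoly_le m hα hβ hβs n k)).trans (hf k)

end laguerrePoly

/-! ### Images of Laguerre entire functions -/

theorem expSeq_zero_right (θ : ℝ) (u : ℕ → ℂ) : expSeq θ 0 u = u := by
  ext k
  rw [expSeq, tsum_eq_single 0 fun j hj => by simp [hj]]
  simp

open scoped ComplexOrder in
theorem expSeq_zero_ne_zero {θ γ : ℝ} (hθ : 0 ≤ θ) (hγ : 0 < γ) {u : ℕ → ℂ} {B r : ℝ}
    (hr : 0 ≤ r) (hrγ : r * γ < 1) (hu : GeomBound B r u) (hu0 : ∀ k, 0 ≤ u k) {k : ℕ}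
    (hk : Ring.multichoose θ k ≠ 0) (huk : u k ≠ 0) : expSeq θ γ u 0 ≠ 0 := by
  have term_nonneg (j : ℕ) :
      0 ≤ ((Ring.multichoose (θ + (0 : ℕ)) j * γ ^ j : ℝ) : ℂ) * u (0 + j) := by
    have coeff_nonneg := multichoose_nonneg (by positivity : 0 ≤ θ + (0 : ℕ)) j
    exact mul_nonneg (Complex.zero_le_real.2 (mul_nonneg coeff_nonneg (pow_nonneg hγ.le j))) (hu0 _)
  intro h
  have sum_zero := (summable_expSeq hθ hγ.le hr hrγ hu 0).hasSum
  rw [← expSeq, h, hasSum_zero_iff_of_nonneg term_nonneg] at sum_zero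
  simpa [hk, huk, hγ.ne'] using congrFun sum_zero k

section laguerreFun

variable {θ γ : ℝ} (hθ : 0 ≤ θ) (hγ : 0 < γ) {B r : ℝ} (hr : 0 ≤ r) (hrγ : r * γ < 1) {m : ℕ}
  {α : ℝ} {β : ℕ → ℝ} (hα : 0 ≤ α) (hβ : ∀ j, 0 ≤ β j) (hβs : Summable β)
  (hf : GeomBound B r (derivs (laguerreFun m α β)))

include hβ hβs in
theorem laguerreFun_one_ne_zero : laguerreFun m α β 1 ≠ 0 := by
  simp only [laguerreFun, one_pow, one_mul, mul_one]
  refine mul_ne_zero (Complex.exp_ne_zero _)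
    (tprod_one_add_ne_zero_of_summable (fun j => ?_) (by simpa using hβs.abs))
  have pos : 0 < 1 + β j := add_pos_of_pos_of_nonneg one_pos (hβ j)
  exact_mod_cast pos.ne'

include hβ hβs in
theorem exists_derivs_laguerreFun_ne_zero : ∃ k, derivs (laguerreFun m α β) k ≠ 0 := by
  by_contra! all_zero
  refine laguerreFun_one_ne_zero hβ hβs (m := m) (α := α) ?_
  rw [← egf_derivs (differentiable_laguerreFun m α hβs)]
  simp [egf, all_zero]

include hθ hγ hr hrγ hα hβ hβs hf in
theorem expSeq_derivs_laguerreFun_zero_ne_zero (h : 0 < θ ∨ m = 0) :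
    expSeq θ γ (derivs (laguerreFun m α β)) 0 ≠ 0 := by
  have nonneg := derivs_laguerreFun_nonneg m hα hβ hβs
  rcases h with hθ | rfl
  · obtain ⟨k, hk⟩ := exists_derivs_laguerreFun_ne_zero hβ hβs (m := m) (α := α)
    exact expSeq_zero_ne_zero hθ.le hγ hr hrγ hf nonneg (multichoose_pos hθ k).ne' hk
  · exact expSeq_zero_ne_zero hθ hγ hr hrγ hf nonneg (k := 0) (by simp)
      (by simp [derivs, laguerreFun])

include hθ hγ hr hrγ hα hβ hβs hf in
theorem isLaguerre_egf_expSeq_of_ne_zero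
    (hne : expSeq θ γ (derivs (laguerreFun m α β)) 0 ≠ 0) :
    IsLaguerre (egf (expSeq θ γ (derivs (laguerreFun m α β)))) := by
  have approx_bound := geomBound_polySeq_laguerrePoly hα hβ hβs hf
  choose q hq image_eq using fun n =>
    (nonposRooted_laguerrePoly m hα hβ n).exists_expSeq hθ hγ.le
  have image_lim (k : ℕ) :
      Tendsto (fun n => polySeq (q n) k) atTop (𝓝 (expSeq θ γ (derivs (laguerreFun m α β)) k)) := by
    simp only [← image_eq]
    exact tendsto_expSeq hθ hγ.le hr hrγ approx_bound
      (tendsto_polySeq_laguerrePoly m hα hβ hβs) k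
  have image_bound (n : ℕ) := image_eq n ▸ (approx_bound n).expSeq hθ hγ.le hr hrγ
  have eval_lim := tendsto_egf image_bound image_lim
  simp only [egf_polySeq] at eval_lim
  refine isLaguerre_of_tendsto_eval hq eval_lim ((image_lim 1).congr fun n => ?_)
    (by rwa [egf_zero])
  rw [polySeq, ← coeff_zero_eq_eval_zero, coeff_derivative]
  simp

end laguerreFun

theorem GeomBound.of_mulSeq {B r : ℝ} {u : ℕ → ℂ} (hu : GeomBound B r (mulSeq u)) :
    GeomBound (B * r) r u := fun k => by
  have one_le : (1 : ℝ) ≤ ‖(k + 1 : ℂ)‖ := by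
    rw [← Nat.cast_succ, Complex.norm_natCast]
    exact_mod_cast k.succ_pos
  calc ‖u k‖ ≤ ‖(k + 1 : ℂ)‖ * ‖u k‖ := le_mul_of_one_le_left (norm_nonneg _) one_le
    _ = ‖mulSeq u (k + 1)‖ := (norm_mul _ _).symm
    _ ≤ B * r ^ (k + 1) := hu _
    _ = B * r * r ^ k := by ring

theorem egf_mulSeq {B r : ℝ} {u : ℕ → ℂ} (hu : GeomBound B r u) :
    egf (mulSeq u) = fun z => z * egf u z :=
  have hd := differentiable_egf hu
  calc egf (mulSeq u) = egf (derivs fun z => z * egf u z) := by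
        rw [derivs_id_mul hd, derivs_egf hu]
    _ = _ := egf_derivs (differentiable_fun_id.mul hd)

theorem egf_smul (s : ℂ) (u : ℕ → ℂ) : egf (s • u) = fun z => s * egf u z := by
  ext z
  simp only [egf, Pi.smul_apply, smul_eq_mul, ← tsum_mul_left, mul_div_assoc, mul_assoc]

theorem IsLaguerre.id_mul {f : ℂ → ℂ} (hf : IsLaguerre f) : IsLaguerre fun z => z * f z := by
  obtain ⟨C, m, α, β, hα, hβ, hanti, hs, h⟩ := hf
  exact ⟨C, m + 1, α, β, hα, hβ, hanti, hs, fun z => by simp only [h]; ring⟩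

theorem IsLaguerre.const_mul {f : ℂ → ℂ} (hf : IsLaguerre f) (s : ℂ) :
    IsLaguerre fun z => s * f z := by
  obtain ⟨C, m, α, β, hα, hβ, hanti, hs, h⟩ := hf
  exact ⟨s * C, m, α, β, hα, hβ, hanti, hs, fun z => by simp only [h]; ring⟩

theorem IsLaguerre.comp_mul {f : ℂ → ℂ} (hf : IsLaguerre f) {s : ℝ} (hs0 : 0 ≤ s) :
    IsLaguerre fun z => f (s * z) := by
  obtain ⟨C, m, α, β, hα, hβ, hanti, hs, h⟩ := hf
  refine ⟨C * s ^ m, m, α * s, fun j => β j * s, by positivity, fun j => mul_nonneg (hβ j) hs0,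
    hanti.mul_const hs0, hs.mul_right s, fun z => ?_⟩
  simp only [h, mul_pow]
  push_cast
  simp only [mul_assoc]

theorem isLaguerre_zero : IsLaguerre fun _ => 0 :=
  ⟨0, 0, 0, 0, le_rfl, fun _ => le_rfl, antitone_const, summable_zero, fun z => by simp⟩

theorem isLaguerre_egf_expSeq_laguerreFun {θ γ : ℝ} (hθ : 0 ≤ θ) (hγ : 0 < γ) {B r : ℝ}
    (hr : 0 ≤ r) (hrγ : r * γ < 1) {m : ℕ} {α : ℝ} {β : ℕ → ℝ} (hα : 0 ≤ α) (hβ : ∀ j, 0 ≤ β j)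
    (hβs : Summable β) (hf : GeomBound B r (derivs (laguerreFun m α β))) :
    IsLaguerre (egf (expSeq θ γ (derivs (laguerreFun m α β)))) := by
  by_cases h : 0 < θ ∨ m = 0
  · exact isLaguerre_egf_expSeq_of_ne_zero hθ hγ hr hrγ hα hβ hβs hf
      (expSeq_derivs_laguerreFun_zero_ne_zero hθ hγ hr hrγ hα hβ hβs hf h)
  -- For `θ = 0` the image of `z g(z)` vanishes at `0`; it is `z` times the `θ = 2` image of `g`.
  push Not at h
  obtain rfl : θ = 0 := h.1.antisymm hθ
  obtain ⟨m, rfl⟩ := Nat.exists_eq_succ_of_ne_zero h.2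
  have fun_succ : laguerreFun (m + 1) α β = fun z => z * laguerreFun m α β z := funext fun z => by
    simp only [laguerreFun]
    ring
  rw [fun_succ, derivs_id_mul (differentiable_laguerreFun m α hβs)] at hf ⊢
  have hg := hf.of_mulSeq
  have two_nonneg : (0 : ℝ) ≤ 0 + 1 + 1 := by norm_num
  rw [expSeq_mulSeq le_rfl hγ.le hr hrγ hg, Complex.ofReal_zero, mul_zero, zero_smul, add_zero,
    egf_mulSeq (hg.expSeq two_nonneg hγ.le hr hrγ)]
  exact (isLaguerre_egf_expSeq_of_ne_zero two_nonneg hγ hr hrγ hα hβ hβs hg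
    (expSeq_derivs_laguerreFun_zero_ne_zero two_nonneg hγ hr hrγ hα hβ hβs hg
      (Or.inl (by norm_num)))).id_mul

theorem IsLaguerre.egf_expSeq {θ γ : ℝ} (hθ : 0 ≤ θ) (hγ : 0 ≤ γ) {B r : ℝ} (hr : 0 ≤ r)
    (hrγ : r * γ < 1) {f : ℂ → ℂ} (hu : GeomBound B r (derivs f)) (hf : IsLaguerre f) :
    IsLaguerre (egf (expSeq θ γ (derivs f))) := by
  have f_laguerre := hf
  obtain ⟨s, m, α, β, hα, hβ, -, hβs, h⟩ := hf
  have hd := differentiable_laguerreFun m α hβs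
  obtain rfl : f = s • laguerreFun m α β := funext fun z => by
    rw [h, Pi.smul_apply, laguerreFun, smul_eq_mul]
    ring
  rcases hγ.eq_or_lt with rfl | hγ
  · rwa [expSeq_zero_right, egf_derivs (hd.const_smul s)]
  rw [derivs_smul s hd] at hu ⊢
  rw [expSeq_smul, egf_smul]
  rcases eq_or_ne s 0 with rfl | hs
  · simpa using isLaguerre_zero
  have hg : GeomBound (‖s‖⁻¹ * B) r (derivs (laguerreFun m α β)) := fun k => by
    have bound := hu k
    rw [Pi.smul_apply, norm_smul] at bound
    rwa [mul_assoc, le_inv_mul_iff₀ (norm_pos_iff.2 hs)]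
  exact (isLaguerre_egf_expSeq_laguerreFun hθ hγ hr hrγ hα hβ hβs hg).const_mul s

theorem egf_expDeltaSeq (a θ ω : ℝ) (u : ℕ → ℂ) :
    egf (expDeltaSeq a θ ω u) = fun z => egf (expSeq θ (gam a ω) u) (Real.exp (a * ω) * z) := by
  ext z
  refine tsum_congr fun k => ?_
  rw [expDeltaSeq, mul_pow]
  ring

theorem mapsTo_expDelta {θ ω a b : ℝ} (hθ : 0 ≤ θ) (ha : 0 ≤ a) (hb : 0 ≤ b)
    (hab : b * gam a ω < 1) :
    Set.MapsTo (expDelta hθ ha hb hab) (Lplus b) (Lplus (cOf a ω b)) := by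
  intro f hf
  obtain ⟨r, hbr, hrγ, -⟩ := exists_cOf_lt hab (lt_add_one (cOf a ω b))
  have hr : 0 < r := hb.trans_lt hbr
  change IsLaguerre (expDelta hθ ha hb hab f).1
  rw [expDelta_apply, egf_expDeltaSeq]
  exact (IsLaguerre.egf_expSeq hθ (gam_nonneg ha ω) hr.le hrγ (f.geomBound ⟨r, hr, hbr⟩)
    hf).comp_mul (Real.exp_nonneg _)

theorem t2Space_A (b : ℝ) : T2Space (A b) := by
  have norms := withSeminorms_normFamily b
  have : IsTopologicalAddGroup (A b) := norms.topologicalAddGroup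
  have : T1Space (A b) := norms.T1_of_separating fun f hf => by
    refine ⟨Classical.arbitrary _, fun norm_zero => hf (A.ext_derivs (funext fun k => ?_))⟩
    have bound := f.geomBound (Classical.arbitrary _) k
    rw [norm_zero, zero_mul] at bound
    rw [norm_le_zero_iff.1 bound, ← zero_smul ℂ (0 : A b), A.derivs_smul, zero_smul, Pi.zero_apply]
  infer_instance

theorem A.derivs_sub {b : ℝ} (f g : A b) : derivs (f - g : A b) = derivs f - derivs g := by
  rw [eq_sub_iff_add_eq, ← A.derivs_add, sub_add_cancel]

/-- A polynomial as an element of `𝓐_b`. -/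
def A.ofPolynomial (b : ℝ) (p : ℂ[X]) : A b := ⟨fun z => p.eval z, fun r => by
  obtain ⟨B, hB⟩ := exists_geomBound_polySeq p r.2.1
  exact GeomBound.memB r.2.1 p.differentiable (derivs_eval p ▸ hB)⟩

theorem A.derivs_ofPolynomial (b : ℝ) (p : ℂ[X]) : derivs (A.ofPolynomial b p) = polySeq p :=
  derivs_eval p

/-- The Taylor polynomial of `f` at `0` of degree less than `N`. -/
def taylorPoly (f : ℂ → ℂ) (N : ℕ) : ℂ[X] := ∑ k ∈ range N, C (derivs f k / (k ! : ℂ)) * X ^ k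

theorem polySeq_taylorPoly (f : ℂ → ℂ) (N k : ℕ) :
    polySeq (taylorPoly f N) k = if k < N then derivs f k else 0 := by
  have h : (k ! : ℂ) ≠ 0 := by exact_mod_cast k.factorial_ne_zero
  simp only [polySeq, taylorPoly, finsetSum_coeff, coeff_C_mul, coeff_X_pow, mul_ite, mul_one,
    mul_zero, sum_ite_eq, mem_range]
  split_ifs
  · field_simp
  · rfl

theorem geomBound_polySeq_taylorPoly_sub {f : ℂ → ℂ} {B r s : ℝ} (hf : GeomBound B s (derivs f))
    (hs : 0 ≤ s) (hr : 0 < r) (hsr : s ≤ r) (N : ℕ) :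
    GeomBound (B * (s / r) ^ N) r (polySeq (taylorPoly f N) - derivs f) := by
  intro k
  have B_nonneg := hf.nonneg
  rw [Pi.sub_apply, polySeq_taylorPoly]
  split_ifs with hk
  · rw [sub_self, norm_zero]
    positivity
  · rw [zero_sub, norm_neg]
    calc ‖derivs f k‖ ≤ B * s ^ k := hf k
      _ = B * (s / r) ^ k * r ^ k := by rw [div_pow]; field_simp
      _ ≤ B * (s / r) ^ N * r ^ k := by
        gcongr B * ?_ * _
        exact pow_le_pow_of_le_one (by positivity) ((div_le_one hr).2 hsr) (not_lt.1 hk)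

theorem tendsto_ofPolynomial_taylorPoly {b : ℝ} (hb : 0 ≤ b) (f : A b) :
    Tendsto (fun N => A.ofPolynomial b (taylorPoly f N)) atTop (𝓝 f) := by
  rw [(withSeminorms_normFamily b).tendsto_nhds]
  intro r ε hε
  obtain ⟨s, hbs, hsr⟩ := exists_between r.2.2
  have hs : 0 < s := hb.trans_lt hbs
  have bound_lim : Tendsto (fun N : ℕ => normFamily b ⟨s, hs, hbs⟩ f * (s / r) ^ N) atTop
      (𝓝 0) := by
    simpa using (tendsto_pow_atTop_nhds_zero_of_lt_one (div_nonneg hs.le r.2.1.le)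
      ((div_lt_one r.2.1).2 hsr)).const_mul (normFamily b ⟨s, hs, hbs⟩ f)
  refine (bound_lim.eventually_lt_const hε).mono fun N hN => lt_of_le_of_lt ?_ hN
  refine GeomBound.bNorm_le r.2.1 ?_
  rw [A.derivs_sub, A.derivs_ofPolynomial]
  exact geomBound_polySeq_taylorPoly_sub (f.geomBound ⟨s, hs, hbs⟩) hs.le r.2.1 hsr.le N

theorem IsExpDelta.eq {a θ ω b c : ℝ} (hb : 0 ≤ b) {E E' : A b →L[ℂ] A c}
    (hE : IsExpDelta a θ ω E) (hE' : IsExpDelta a θ ω E') : E' = E := by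
  have := t2Space_A c
  ext1 f
  have taylor_lim := tendsto_ofPolynomial_taylorPoly hb f
  have eq_taylor (N : ℕ) :
      E (A.ofPolynomial b (taylorPoly f N)) = E' (A.ofPolynomial b (taylorPoly f N)) :=
    Subtype.ext <| funext fun z =>
      (hE _ _ (fun _ => rfl) z).unique (hE' _ _ (fun _ => rfl) z)
  exact tendsto_nhds_unique ((E'.continuous.tendsto f).comp taylor_lim)
    (((E.continuous.tendsto f).comp taylor_lim).congr eq_taylor)

theorem isExpDelta_expDelta {θ ω a b : ℝ} (hθ : 0 ≤ θ) (ha : 0 ≤ a) (hb : 0 ≤ b)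
    (hab : b * gam a ω < 1) : IsExpDelta a θ ω (expDelta hθ ha hb hab) := by
  intro f p hfp
  obtain ⟨r, hr, hrγ⟩ := exists_pos_mul_lt one_pos (gam a |ω|)
  obtain ⟨B, hB⟩ := exists_geomBound_polySeq p hr
  have hf : f.1 = fun z => p.eval z := funext hfp
  rw [expDelta_apply]
  refine hasSeries_egf_expDeltaSeq hθ ha f.differentiable hr.le (mul_comm r _ ▸ hrγ) (B := B) ?_
  rwa [hf, derivs_eval]

theorem hasSeries_expDelta {θ ω a b : ℝ} (hθ : 0 ≤ θ) (ha : 0 ≤ a) (hb : 0 ≤ b)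
    (hab : b * gam a ω < 1) (hab' : b * gam a |ω| < 1) (f : A b) :
    HasSeries (fun z => Complex.exp (a * z)) θ ω f (expDelta hθ ha hb hab f) := by
  obtain ⟨r, hbr, hrγ, -⟩ := exists_cOf_lt hab' (lt_add_one (cOf a |ω| b))
  have hr : 0 < r := hb.trans_lt hbr
  rw [expDelta_apply]
  exact hasSeries_egf_expDeltaSeq hθ ha f.differentiable hr.le hrγ (f.geomBound ⟨r, hr, hbr⟩)

end LaguerreOp

end

theorem theorem2p30 (θ ω a b : ℝ) (hθ : 0 ≤ θ) (ha : 0 ≤ a) (hb : 0 ≤ b)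
    (hab : b * LaguerreOp.gam a ω < 1) :
    ∃ E : LaguerreOp.A b →L[ℂ] LaguerreOp.A (LaguerreOp.cOf a ω b),
      LaguerreOp.IsExpDelta a θ ω E ∧
      (∀ E' : LaguerreOp.A b →L[ℂ] LaguerreOp.A (LaguerreOp.cOf a ω b),
        LaguerreOp.IsExpDelta a θ ω E' → E' = E) ∧
      (b * LaguerreOp.gam a |ω| < 1 → ∀ f : LaguerreOp.A b,
        LaguerreOp.HasSeries (fun z => Complex.exp (a * z)) θ ω f (E f)) ∧
      ∃ hE : Set.MapsTo E (LaguerreOp.Lplus b) (LaguerreOp.Lplus (LaguerreOp.cOf a ω b)),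
        Continuous (hE.restrict E (LaguerreOp.Lplus b)
          (LaguerreOp.Lplus (LaguerreOp.cOf a ω b))) := by
  have hE := LaguerreOp.isExpDelta_expDelta hθ ha hb hab
  exact ⟨LaguerreOp.expDelta hθ ha hb hab, hE, fun E' hE' => hE.eq hb hE',
    LaguerreOp.hasSeries_expDelta hθ ha hb hab, LaguerreOp.mapsTo_expDelta hθ ha hb hab,
    (LaguerreOp.expDelta hθ ha hb hab).continuous.restrict _⟩
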